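/- Let $V$ be a finite-dimensional Hermitian inner product space, $n=\dim_{\mathbb C}V\ge 1$, and let $K$ be a closed subgroup of $U(V)$ acting on the holomorphic polynomials $\mathbb C[V]$ by $(k.p)(z)=p(k^{-1}z)$. Assume the action is multiplicity free: $\mathbb C[V]=\bigoplus_{\lambda\in\Lambda}P_\lambda$ with $P_\lambda$ finite-dimensional, irreducible and pairwise inequivalent as representations of $K$. Let $d_\lambda=\dim P_\lambda$ and let $|\lambda|$ be the degree of homogeneity of the elements of $P_\lambda$. With $\langle f,g\rangle_1=\pi^{-n}\int_V f\bar g\,e^{-\langle z,z\rangle}\,dz$, put $p_\lambda=d_\lambda^{-1}\sum_{j=1}^{d_\lambda} v_j\overline{v_j}$ for an orthonormal basis $(v_j)$ of $(P_\lambda,\langle\cdot,\cdot\rangle_1)$. Let $(q_\lambda)_{\lambda\in\Lambda}$ be obtained from $(p_\lambda)_{\lambda\in\Lambda}$ by Gram--Schmidt orthogonalization for $\langle\cdot,\cdot\rangle_1$, along any enumeration of $\Lambda$ in which $\alpha$ precedes $\beta$ whenever $|\alpha|<|\beta|$, with the normalization $q_\lambda(0)=1$. The generalized binomial coefficients are the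 numbers $\left[{\lambda\atop\alpha}\right]$ defined by $q_\lambda=\sum_{|\alpha|\le|\lambda|}(-1)^{|\alpha|}\left[{\lambda\atop\alpha}\right]p_\alpha$, and $\left[{\lambda\atop\alpha}\right]=0$ for $|\alpha|>|\lambda|$. By a Markov chain with transition rates $q$ we mean a process $(X_t)_{t\ge0}$ (with arbitrary initial law) that is Markov with respect to its natural filtration and whose semigroup of transition probabilities $(p_t)_{t\ge0}$ satisfies $\frac{\partial}{\partial t}p_t(\alpha,\beta)\big|_{t=0}=q(\alpha,\beta)$ for all states $\alpha,\beta$. (Birth.) Let $(X_t)_{t\ge0}$ be a Markov chain on $\Lambda$ with rates $$q^+(\alpha,\beta)=\begin{cases}\frac{d_\beta}{d_\alpha}\left[{\beta\atop\alpha}\right],&|\beta|=|\alpha|+1,\\ -n-|\alpha|,&\alpha=\beta,\\0,&\text{otherwise.}\end{cases}$$ Then $(|X_t|)_{t\ge0}$ is a Markov chain on $\mathbb N=\{0,1,2,\dots\}$: it is the Yule process with immigration rate $n$ and individual birth rate $1$ (rate $k+n$ for $k\to k+1$, rate $-(k+n)$ on the diagonal, all other rates $0$), and its transition probabilities are $$p_t^+(k,l)=\binom{l+n-1}{k+n-1}(1-e^{-t})^{l-k}(e^{-t})^{k+n}\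 \text{ if } l\ge k,\qquad p_t^+(k,l)=0\ \text{ otherwise.}$$ (Death.) Let $(X_t)_{t\ge0}$ be a Markov chain on $\Lambda$ with rates $$q^-(\alpha,\beta)=\begin{cases}\left[{\alpha\atop\beta}\right],&|\alpha|=|\beta|+1,\\ -|\alpha|,&\alpha=\beta,\\0,&\text{otherwise.}\end{cases}$$ Then $(|X_t|)_{t\ge0}$ is a Markov chain on $\mathbb N$: it is the pure death process with individual death rate $1$ (rate $k$ for $k\to k-1$, rate $-k$ on the diagonal, all other rates $0$), and its transition probabilities are $$p_t^-(k,l)=\binom{k}{l}e^{-lt}(1-e^{-t})^{k-l}\ \text{ if } k\ge l,\qquad p_t^-(k,l)=0\ \text{ otherwise.}$$ -/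

import Mathlib

open MeasureTheory
open scoped NNReal ComplexConjugate

noncomputable section

namespace MultFree

/-! ### Polynomials on a Hermitian space and the action of a group of unitary operators -/

section Action

variable {V : Type*} [NormedAddCommGroup V] [InnerProductSpace ℂ V]

/-- The algebra `ℂ[V]` of holomorphic polynomials on `V`: the algebra of functions on `V`
generated by the complex linear functionals. -/
def holPoly (V : Type*) [NormedAddCommGroup V] [InnerProductSpace ℂ V] :
    Subalgebra ℂ (V → ℂ) :=
  Algebra.adjoin ℂ {f : V → ℂ | ∃ l : V →ₗ[ℂ] ℂ, f = l}

/-- `K` is a closed subgroup of the unitary group `U(V)` (closed for the operator norm). -/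
def IsClosedSubgroup (K : Subgroup (V ≃ₗᵢ[ℂ] V)) : Prop :=
  IsClosed ((fun k : V ≃ₗᵢ[ℂ] V => (k.toContinuousLinearEquiv : V →L[ℂ] V)) ''
    (K : Set (V ≃ₗᵢ[ℂ] V)))

/-- The action `(k.p)(z) = p(k⁻¹.z)` of `K` on functions on `V`. -/
def polyRep (K : Subgroup (V ≃ₗᵢ[ℂ] V)) : Representation ℂ K (V → ℂ) where
  toFun k := LinearMap.funLeft ℂ ℂ (fun z : V => ((k⁻¹ : K) : V ≃ₗᵢ[ℂ] V) z)
  map_one' := by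
    ext f z
    simp [LinearMap.funLeft]
  map_mul' k l := by
    ext f z
    simp [LinearMap.funLeft]

/-- `(P_λ)` is a decomposition of `ℂ[V]` as the direct sum of finite-dimensional irreducible
`K`-subspaces which are pairwise inequivalent as representations of `K`. An action of `K` is
multiplicity free when there is such a decomposition. -/
structure IsMultiplicityFreeDecomposition (K : Subgroup (V ≃ₗᵢ[ℂ] V)) {Λ : Type*}
    (P : Λ → Subrepresentation (polyRep K)) : Prop where
  iSup_eq : ⨆ a, (P a).toSubmodule = Subalgebra.toSubmodule (holPoly V)
  iSupIndep : iSupIndep fun a => (P a).toSubmodule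
  finiteDimensional : ∀ a, FiniteDimensional ℂ (P a).toSubmodule
  irreducible : ∀ a, (P a).toRepresentation.IsIrreducible
  inequivalent : ∀ a b, a ≠ b →
    IsEmpty (Representation.Equiv (P a).toRepresentation (P b).toRepresentation)

/-- The degree of homogeneity of a space `W` of polynomials: the `m` such that every member of
`W` is homogeneous of degree `m` (unique if there is one and `W ≠ 0`). -/
def homDegree (W : Submodule ℂ (V → ℂ)) : ℕ :=
  sInf {m : ℕ | ∀ f ∈ W, ∀ (c : ℂ) (z : V), f (c • z) = c ^ m * f z}

end Action

/-! ### Invariant polynomials and generalized binomial coefficients -/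

section Fock

variable {V : Type*} [NormedAddCommGroup V] [InnerProductSpace ℂ V] [FiniteDimensional ℂ V]
  [MeasurableSpace V] [BorelSpace V]

/-- Lebesgue measure on the real Euclidean space underlying `V` (with `Re ⟨z, w⟩` as inner
product). -/
def lebesgue (V : Type*) [NormedAddCommGroup V] [InnerProductSpace ℂ V] [FiniteDimensional ℂ V]
    [MeasurableSpace V] [BorelSpace V] : Measure V :=
  letI : InnerProductSpace ℝ V := InnerProductSpace.complexToReal
  volume

/-- The Fock inner product `⟨f, g⟩₁ = π⁻ⁿ ∫_V f(z) conj(g(z)) exp(-⟨z, z⟩) dz`. -/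
def fock (f g : V → ℂ) : ℂ :=
  ((1 / Real.pi) ^ Module.finrank ℂ V : ℝ) *
    ∫ z, f z * conj (g z) * (Real.exp (-‖z‖ ^ 2) : ℂ) ∂(lebesgue V)

/-- `v` is an orthonormal basis of the space `W` of polynomials, for the Fock inner product. -/
structure IsFockONB (W : Submodule ℂ (V → ℂ)) (v : Fin (Module.finrank ℂ W) → V → ℂ) :
    Prop where
  span_eq : Submodule.span ℂ (Set.range v) = W
  orthonormal : ∀ i j, fock (v i) (v j) = if i = j then 1 else 0

/-- The polynomial `z ↦ d⁻¹ ∑_j v_j(z) conj(v_j(z))`. -/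
def invPoly {d : ℕ} (v : Fin d → V → ℂ) : V → ℂ :=
  fun z => (1 / (d : ℂ)) * ∑ j, v j z * conj (v j z)

/-- The Gram–Schmidt orthogonalization of a sequence, for the Fock inner product. -/
def fockGramSchmidt (f : ℕ → V → ℂ) (k : ℕ) : V → ℂ :=
  f k - ∑ j : Fin k,
    (fock (f k) (fockGramSchmidt f j) /
      fock (fockGramSchmidt f j) (fockGramSchmidt f j)) • fockGramSchmidt f j
termination_by k
decreasing_by all_goals exact j.2

variable {Λ : Type*}

/-- The polynomials `q_λ`: the family `(p_λ)` is orthogonalized in the order `e 0, e 1, …` of the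
index set and normalized by `q_λ(0) = 1`. -/
def orthPoly (p : Λ → V → ℂ) (e : ℕ ≃ Λ) (a : Λ) : V → ℂ :=
  (fockGramSchmidt (p ∘ e) (e.symm a) 0)⁻¹ • fockGramSchmidt (p ∘ e) (e.symm a)

/-- The generalized binomial coefficients `[a, b]`, that is, the numbers in
`q_a = ∑_{|b| ≤ |a|} (-1)^|b| [a, b] p_b`, extended by `0` to `|b| > |a|`.
Here `Function.invFun (Finsupp.linearCombination ℂ p)` sends a linear combination of the
linearly independent family `p` to its coefficients. -/
def genBinom (deg : Λ → ℕ) (p : Λ → V → ℂ) (e : ℕ ≃ Λ) (a b : Λ) : ℝ :=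
  if deg b ≤ deg a then
    (-1) ^ deg b * (Function.invFun (Finsupp.linearCombination ℂ p) (orthPoly p e a) b).re
  else 0

end Fock

/-! ### Continuous-time Markov chains on a countable state space -/

section Chains

/-- A semigroup of transition probabilities on `S` (indexed by `t ≥ 0`). -/
structure IsTransitionSemigroup {S : Type*} (p : ℝ → S → S → ℝ) : Prop where
  nonneg : ∀ t, 0 ≤ t → ∀ a b, 0 ≤ p t a b
  hasSum_one : ∀ t, 0 ≤ t → ∀ a, HasSum (p t a) 1
  zero_self : ∀ a, p 0 a a = 1
  zero_ne : ∀ a b, a ≠ b → p 0 a b = 0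
  chapman_kolmogorov : ∀ s t, 0 ≤ s → 0 ≤ t → ∀ a b,
    HasSum (fun c => p s a c * p t c b) (p (s + t) a b)

/-- `q` is the matrix of transition rates of `p`, that is, `q(a, b) = ∂p_t(a, b)/∂t|_{t=0}`. -/
def HasTransitionRates {S : Type*} (p : ℝ → S → S → ℝ) (q : S → S → ℝ) : Prop :=
  ∀ a b, HasDerivWithinAt (fun t => p t a b) (q a b) (Set.Ici 0) 0

/-- The `σ`-algebra generated by `X_u`, `u ≤ s` (the natural filtration of `X`), the state space
carrying the discrete `σ`-algebra. -/
abbrev past {Ω S : Type*} (X : ℝ≥0 → Ω → S) (s : ℝ≥0) : MeasurableSpace Ω :=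
  ⨆ u : Set.Iic s, MeasurableSpace.comap (X u) ⊤

/-- `X` is a Markov chain on `S` with respect to its natural filtration, with transition
semigroup `p` and transition rates `q`; its initial law is arbitrary. -/
structure IsMarkovChain {Ω S : Type*} [MeasurableSpace Ω] (μ : Measure Ω)
    (X : ℝ≥0 → Ω → S) (p : ℝ → S → S → ℝ) (q : S → S → ℝ) : Prop where
  semigroup : IsTransitionSemigroup p
  rates : HasTransitionRates p q
  measurable : ∀ t, Measurable[_, ⊤] (X t)
  markov : ∀ (s t : ℝ≥0) (b : S),
    μ[(X (s + t) ⁻¹' {b}).indicator (fun _ => (1 : ℝ)) | past X s]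
      =ᵐ[μ] fun ω => p t (X s ω) b

variable {Λ : Type*}

open Classical in
/-- The birth rates on `Λ`, for the degree `deg`, the dimensions `d`, the generalized binomial
coefficients `B a b = [a, b]` and the dimension `n` of the space. -/
def birthRate (n : ℕ) (deg d : Λ → ℕ) (B : Λ → Λ → ℝ) (a b : Λ) : ℝ :=
  if deg b = deg a + 1 then (d b : ℝ) / d a * B b a
  else if a = b then -(n : ℝ) - deg a
  else 0

open Classical in
/-- The death rates on `Λ`. -/
def deathRate (deg : Λ → ℕ) (B : Λ → Λ → ℝ) (a b : Λ) : ℝ :=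
  if deg a = deg b + 1 then B a b
  else if a = b then -(deg a : ℝ)
  else 0

/-- Rates of the Yule process with immigration rate `n` and individual birth rate `1`. -/
def yuleRate (n : ℕ) (k l : ℕ) : ℝ :=
  if l = k + 1 then (k : ℝ) + n
  else if k = l then -((k : ℝ) + n)
  else 0

/-- Rates of the pure death process on `ℕ` with individual death rate `1`. -/
def linearDeathRate (k l : ℕ) : ℝ :=
  if k = l + 1 then (k : ℝ)
  else if k = l then -(k : ℝ)
  else 0

/-- Transition probabilities of the case `K = U(n)`, birth process. -/
def yuleProb (n : ℕ) (t : ℝ) (k l : ℕ) : ℝ :=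
  if k ≤ l then
    ((l + n - 1).choose (k + n - 1) : ℝ) * (1 - Real.exp (-t)) ^ (l - k) *
      Real.exp (-t) ^ (k + n)
  else 0

/-- Transition probabilities of the case `K = U(n)`, death process. -/
def linearDeathProb (t : ℝ) (k l : ℕ) : ℝ :=
  if l ≤ k then
    (k.choose l : ℝ) * Real.exp (-(l * t)) * (1 - Real.exp (-t)) ^ (k - l)
  else 0

end Chains

end MultFree

end

/-!
Write `Δ = ∑ i, ∂_{z_i} ∂_{conj z_i}` for the Laplace operator on `V`. The argument has an algebraic
half, which computes the total jump rates from a state `a` to the neighbouring levels of the degree,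
and a probabilistic half, which shows that these totals determine the law of the degree.

**The polynomials `q_a`.** For homogeneous holomorphic `F`, `G` the function `exp(-Δ) (F * conj G)`
is a complex Hermite polynomial: its integral against `u * conj w` is `⟨u, G⟩₁ ⟨F, w⟩₁` as soon as
`deg u ≤ deg G` (`IsFockForm.hermite_eq`). The only input is that multiplication by `z_i` is adjoint
to `∂_i` (`fock_pderiv`). Hence the functions `exp(-Δ) p_a` are mutually orthogonal. By Schur's
lemma, `exp(-Δ) p_a` is `p_a` plus a combination of the `p_b` of smaller degree
(`IsMultFreeSystem.exists_hermiteAverage_eq`), so Gram–Schmidt produces exactly `exp(-Δ) p_a`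
(`IsMultFreeSystem.fockGramSchmidt_average`), whose value at `0` is `(-1) ^ |a|`. Therefore
`q_a = (-1) ^ |a| exp(-Δ) p_a`. For `|a| = |b| + 1` only the first power of `Δ` contributes to the
coefficient of `p_b`, and it gives `[a, b] = N(a, b) / d_a`, where
`N(a, b) = ∑ |⟨z_l v_i, w_j⟩₁|²` is a sum over the coordinates `l` and the orthonormal bases `(v_i)`
of `P_b` and `(w_j)` of `P_a` (`IsMultFreeSystem.genBinom_average`).

**The total rates.** The birth rate from `a` to `b` is thus `N(b, a) / d_a` and the death rate is
`N(a, b) / d_a`. By Parseval's identity, summing `N` over a level gives the traces on `P_a` of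
`∑ ∂_l z_l` and of `∑ z_l ∂_l`, and by Euler's identity these operators are `n + |a|` and `|a|`
(`sum_birthRate`, `sum_deathRate`).

**Lumping.** Levels are finite, so the probability of moving from `a` to the level `l` within time
`t` satisfies the backward equation of the chain, and by the preceding computation this is the
backward equation of the Yule process, respectively of the linear death process, on `ℕ`. Solutions
with the given initial values are unique: for the death process by induction on the degree, and for
the Yule process because it does not explode (`sum_level_eq_yuleProb`,
`sum_level_eq_linearDeathProb`). So the transition probabilities to a level depend on the degree
only, and the degree inherits the Markov property (`IsMarkovChain.map_deg`).

Polynomials in `z` and `conj z` are handled through sesquilinear forms `φ` on holomorphic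
polynomials, `φ F G` standing for `F * conj G` or for a linear image of it. Then `Δ` becomes
`contract`, and pairing `exp(-Δ)` with a fixed function becomes `hermite` of a complex-valued form.
-/

noncomputable section

namespace MultFree

/-! ### Backward equations for lumped transition probabilities -/

section Backward

variable {S : Type*} {p : ℝ → S → S → ℝ}

theorem IsTransitionSemigroup.le_one (hp : IsTransitionSemigroup p) {t : ℝ} (ht : 0 ≤ t)
    (a b : S) : p t a b ≤ 1 :=
  le_hasSum (hp.hasSum_one t ht a) b fun c _ => hp.nonneg t ht a c

theorem IsTransitionSemigroup.sum_le_one (hp : IsTransitionSemigroup p) {t : ℝ} (ht : 0 ≤ t)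
    (a : S) (s : Finset S) : ∑ b ∈ s, p t a b ≤ 1 :=
  sum_le_hasSum s (fun c _ => hp.nonneg t ht a c) (hp.hasSum_one t ht a)

/-- The Chapman–Kolmogorov sum restricted to a finite set `s` of intermediate states misses at
most the probability of not being in `s` at the intermediate time. -/
theorem IsTransitionSemigroup.chapman_kolmogorov_finset (hp : IsTransitionSemigroup p) {h t : ℝ}
    (hh : 0 ≤ h) (ht : 0 ≤ t) (a b : S) (s : Finset S) :
    0 ≤ p (h + t) a b - ∑ c ∈ s, p h a c * p t c b ∧
      p (h + t) a b - ∑ c ∈ s, p h a c * p t c b ≤ 1 - ∑ c ∈ s, p h a c := by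
  have h1 := hp.chapman_kolmogorov h t hh ht a b
  refine ⟨sub_nonneg.2 (sum_le_hasSum s
    (fun c _ => mul_nonneg (hp.nonneg h hh a c) (hp.nonneg t ht c b)) h1), ?_⟩
  have h2 := (hp.hasSum_one h hh a).sub h1
  have h3 := sum_le_hasSum s (fun c _ => by
    have := hp.nonneg h hh a c
    have := hp.le_one ht c b
    nlinarith) h2
  simp only [Finset.sum_sub_distrib] at h3
  linarith

theorem IsTransitionSemigroup.abs_sub_le (hp : IsTransitionSemigroup p) {h t : ℝ}
    (hh : 0 ≤ h) (ht : 0 ≤ t) (a b : S) : |p (h + t) a b - p t a b| ≤ 1 - p h a a := by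
  have h1 := hp.chapman_kolmogorov_finset hh ht a b {a}
  simp only [Finset.sum_singleton] at h1
  have h2 := hp.nonneg t ht a b
  have h3 := hp.le_one ht a b
  have h4 := hp.le_one hh a a
  rw [abs_le]
  constructor <;> nlinarith [h1.1, h1.2]

theorem continuousOn_of_hasTransitionRates (hp : IsTransitionSemigroup p) {q : S → S → ℝ}
    (hq : HasTransitionRates p q) (a b : S) : ContinuousOn (fun t => p t a b) (Set.Ici 0) := by
  have h0 : Filter.Tendsto (fun h => 1 - p h a a) (nhdsWithin 0 (Set.Ici 0)) (nhds 0) := by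
    have := (hq a a).continuousWithinAt.tendsto
    rw [hp.zero_self] at this
    simpa using this.const_sub 1
  intro t ht
  have habs : Filter.Tendsto (fun s => |s - t|) (nhdsWithin t (Set.Ici 0))
      (nhdsWithin 0 (Set.Ici 0)) := by
    refine tendsto_nhdsWithin_iff.2 ⟨?_, Filter.Eventually.of_forall fun s => abs_nonneg (s - t)⟩
    have : Continuous fun s : ℝ => |s - t| := by fun_prop
    simpa using (this.tendsto t).mono_left nhdsWithin_le_nhds
  refine tendsto_iff_norm_sub_tendsto_zero.2
    (squeeze_zero' (Filter.Eventually.of_forall fun _ => norm_nonneg _) ?_ (h0.comp habs))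
  filter_upwards [self_mem_nhdsWithin] with s hs
  rw [Set.mem_Ici] at hs ht
  simp only [Function.comp, Real.norm_eq_abs]
  rcases le_total t s with h | h
  · have := hp.abs_sub_le (sub_nonneg.2 h) ht a b
    rw [sub_add_cancel] at this
    rwa [abs_of_nonneg (sub_nonneg.2 h)]
  · have := hp.abs_sub_le (sub_nonneg.2 h) hs a b
    rw [sub_add_cancel, abs_sub_comm] at this
    rwa [abs_sub_comm s t, abs_of_nonneg (sub_nonneg.2 h)]

/-- **Kolmogorov's backward equation**, for right derivatives, when the row of the rate matrix at
`a` is supported in a finite set and sums to zero. -/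
theorem hasDerivWithinAt_backward (hp : IsTransitionSemigroup p) {q : S → S → ℝ}
    (hq : HasTransitionRates p q) (a b : S) (s : Finset S) (has : a ∈ s)
    (hs : ∑ c ∈ s, q a c = 0) {t : ℝ} (ht : 0 ≤ t) :
    HasDerivWithinAt (fun u => p u a b) (∑ c ∈ s, q a c * p t c b) (Set.Ici t) t := by
  classical
  -- the defect in the Chapman–Kolmogorov sum over `s` is squeezed by a function with derivative 0
  have hR : HasDerivWithinAt (fun h => 1 - ∑ c ∈ s, p h a c) 0 (Set.Ici 0) 0 := by
    have := (HasDerivWithinAt.fun_sum (u := s) fun c _ => hq a c).const_sub 1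
    simpa [hs] using this
  have hsum0 : ∀ f : S → ℝ, ∑ c ∈ s, p 0 a c * f c = f a := fun f => by
    rw [Finset.sum_eq_single a]
    · rw [hp.zero_self, one_mul]
    · intro c _ hc
      rw [hp.zero_ne a c hc.symm, zero_mul]
    · exact fun h => absurd has h
  have hR0 : 1 - ∑ c ∈ s, p 0 a c = 0 := by
    have := hsum0 fun _ => 1
    simp only [mul_one] at this
    rw [this, sub_self]
  have hφ : HasDerivWithinAt (fun h => p (h + t) a b - ∑ c ∈ s, p h a c * p t c b) 0
      (Set.Ici 0) 0 := by
    rw [hasDerivWithinAt_iff_isLittleO] at hR ⊢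
    refine Asymptotics.IsBigO.trans_isLittleO ?_ hR
    refine Asymptotics.IsBigO.of_bound 1 ?_
    filter_upwards [self_mem_nhdsWithin] with h hh
    have := hp.chapman_kolmogorov_finset hh ht a b s
    rw [hR0, hsum0 fun c => p t c b]
    simp only [zero_add, sub_self, sub_zero, smul_zero, one_mul, Real.norm_eq_abs]
    rw [abs_of_nonneg this.1, abs_of_nonneg (this.1.trans this.2)]
    exact this.2
  have hsum : HasDerivWithinAt (fun h => ∑ c ∈ s, p h a c * p t c b)
      (∑ c ∈ s, q a c * p t c b) (Set.Ici 0) 0 :=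
    HasDerivWithinAt.fun_sum fun c _ => (hq a c).mul_const _
  have hadd : HasDerivWithinAt (fun h => p (h + t) a b) (∑ c ∈ s, q a c * p t c b)
      (Set.Ici 0) 0 := by
    simpa using hφ.fun_add hsum
  have hcomp : HasDerivWithinAt (fun u : ℝ => u - t) 1 (Set.Ici t) t :=
    ((hasDerivAt_id t).sub_const t).hasDerivWithinAt
  have := HasDerivWithinAt.scomp (h := fun u : ℝ => u - t) (t' := Set.Ici 0) t
    (by simpa using hadd) hcomp (fun u hu => by simpa using hu)
  simpa [Function.comp_def] using this

/-- A solution of `u' = ρ - r u` with `u 0 = 0` is bounded by the solution of the same equation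
with the larger source `r B + B'`. -/
theorem abs_le_of_hasDerivWithinAt_sub {u ρ B B' : ℝ → ℝ} {r : ℝ}
    (hu : ContinuousOn u (Set.Ici 0))
    (hu' : ∀ t, 0 ≤ t → HasDerivWithinAt u (ρ t - r * u t) (Set.Ici t) t)
    (hu0 : u 0 = 0) (hB0 : 0 ≤ B 0) (hB : ∀ t, HasDerivAt B (B' t) t)
    (hρ : ∀ t, 0 ≤ t → |ρ t| ≤ r * B t + B' t) {t : ℝ} (ht : 0 ≤ t) : |u t| ≤ B t := by
  have hexp : ∀ s, HasDerivAt (fun s => Real.exp (r * s)) (r * Real.exp (r * s)) s := fun s => by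
    have := ((hasDerivAt_id s).const_mul r).exp
    simpa [mul_comm] using this
  have key := image_norm_le_of_norm_deriv_right_le_deriv_boundary (a := 0) (b := t)
    (f := fun s => Real.exp (r * s) * u s) (f' := fun s => Real.exp (r * s) * ρ s)
    (B := fun s => Real.exp (r * s) * B s)
    (B' := fun s => Real.exp (r * s) * (r * B s + B' s))
    (ContinuousOn.mul (by fun_prop) (hu.mono Set.Icc_subset_Ici_self))
    (fun s hs => by
      refine ((hexp s).hasDerivWithinAt.fun_mul (hu' s hs.1)).congr_deriv ?_
      ring)
    (by simpa [hu0] using hB0)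
    (fun s => by
      refine ((hexp s).fun_mul (hB s)).congr_deriv ?_
      ring)
    (fun s hs => by
      rw [norm_mul, Real.norm_eq_abs, abs_of_pos (Real.exp_pos _), Real.norm_eq_abs]
      exact mul_le_mul_of_nonneg_left (hρ s hs.1) (Real.exp_pos _).le)
    (Set.right_mem_Icc.2 ht)
  simp only [norm_mul, Real.norm_eq_abs, abs_of_pos (Real.exp_pos _)] at key
  exact le_of_mul_le_mul_left key (Real.exp_pos _)

end Backward

/-! ### The Yule process and the linear death process -/

section Explicit

theorem hasDerivAt_exp_neg (t : ℝ) :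
    HasDerivAt (fun t : ℝ => Real.exp (-t)) (-Real.exp (-t)) t := by
  simpa using (hasDerivAt_neg t).exp

/-- The backward equation of the Yule process. -/
theorem hasDerivAt_yuleProb {n : ℕ} (hn : 0 < n) (k l : ℕ) (t : ℝ) :
    HasDerivAt (fun t => yuleProb n t k l)
      (((k : ℝ) + n) * yuleProb n t (k + 1) l - ((k : ℝ) + n) * yuleProb n t k l) t := by
  have hx := hasDerivAt_exp_neg t
  rcases lt_trichotomy l k with h | rfl | h
  · simp only [yuleProb, if_neg (show ¬ k ≤ l by omega), if_neg (show ¬ k + 1 ≤ l by omega)]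
    simpa using hasDerivAt_const t (0 : ℝ)
  · simp only [yuleProb, le_refl, if_true, if_neg (show ¬ l + 1 ≤ l by omega), Nat.choose_self,
      Nat.sub_self, pow_zero, Nat.cast_one, one_mul]
    refine (hx.fun_pow (l + n)).congr_deriv ?_
    obtain ⟨n, rfl⟩ : ∃ m, n = m + 1 := ⟨n - 1, by omega⟩
    rw [show l + (n + 1) - 1 = l + n by omega]
    push_cast
    ring
  · obtain ⟨j, rfl⟩ : ∃ j, l = k + 1 + j := ⟨l - (k + 1), by omega⟩
    obtain ⟨n, rfl⟩ : ∃ m, n = m + 1 := ⟨n - 1, by omega⟩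
    simp only [yuleProb, if_pos (show k ≤ k + 1 + j by omega),
      if_pos (show k + 1 ≤ k + 1 + j by omega)]
    rw [show k + 1 + j - k = j + 1 by omega, show k + 1 + j - (k + 1) = j by omega,
      show k + 1 + j + (n + 1) - 1 = (k + n) + 1 + j by omega,
      show k + (n + 1) - 1 = k + n by omega, show k + 1 + (n + 1) - 1 = k + n + 1 by omega]
    have h1 := (((hx.const_sub 1).fun_pow (j + 1)).const_mul
      (((k + n + 1 + j).choose (k + n) : ℕ) : ℝ)).fun_mul (hx.fun_pow (k + (n + 1)))
    refine h1.congr_deriv ?_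
    have hc : ((k : ℝ) + n + 1) * ((k + n + 1 + j).choose (k + n + 1) : ℝ) =
        (j + 1) * ((k + n + 1 + j).choose (k + n) : ℝ) := by
      have := Nat.choose_succ_right_eq (k + n + 1 + j) (k + n)
      rw [show k + n + 1 + j - (k + n) = j + 1 by omega] at this
      have h2 : (((k + n + 1 + j).choose (k + n + 1) * (k + n + 1) : ℕ) : ℝ) =
        (((k + n + 1 + j).choose (k + n) * (j + 1) : ℕ) : ℝ) := by rw [this]
      push_cast at h2
      linarith
    rw [show k + (n + 1) - 1 = k + n by omega, show j + 1 - 1 = j by omega]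
    push_cast
    linear_combination -(1 - Real.exp (-t)) ^ j * Real.exp (-t) ^ (k + 1 + (n + 1)) * hc

/-- The backward equation of the linear death process. -/
theorem hasDerivAt_linearDeathProb (k l : ℕ) (t : ℝ) :
    HasDerivAt (fun t => linearDeathProb t k l)
      ((k : ℝ) * linearDeathProb t (k - 1) l - (k : ℝ) * linearDeathProb t k l) t := by
  have hx := hasDerivAt_exp_neg t
  have he : ∀ (l : ℕ) (t : ℝ), Real.exp (-(l * t)) = Real.exp (-t) ^ l := fun l t => by
    rw [← Real.exp_nat_mul]
    ring_nf
  simp only [linearDeathProb, he]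
  rcases lt_trichotomy k l with h | rfl | h
  · simp only [if_neg (show ¬ l ≤ k by omega), if_neg (show ¬ l ≤ k - 1 by omega)]
    simpa using hasDerivAt_const t (0 : ℝ)
  · simp only [le_refl, if_true, Nat.choose_self, Nat.sub_self, pow_zero, Nat.cast_one, one_mul,
      mul_one]
    rcases k with _ | k
    · simpa using hasDerivAt_const t (1 : ℝ)
    · rw [if_neg (by omega)]
      refine (hx.fun_pow (k + 1)).congr_deriv ?_
      rw [show k + 1 - 1 = k by omega]
      push_cast
      ring
  · obtain ⟨j, rfl⟩ : ∃ j, k = l + 1 + j := ⟨k - (l + 1), by omega⟩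
    simp only [if_pos (show l ≤ l + 1 + j by omega), if_pos (show l ≤ l + 1 + j - 1 by omega)]
    rw [show l + 1 + j - l = j + 1 by omega, show l + 1 + j - 1 - l = j by omega,
      show l + 1 + j - 1 = l + j by omega]
    have h1 := ((hx.fun_pow l).const_mul (((l + 1 + j).choose l : ℕ) : ℝ)).fun_mul
      ((hx.const_sub 1).fun_pow (j + 1))
    refine h1.congr_deriv ?_
    have hc : ((l : ℝ) + 1 + j) * ((l + j).choose l : ℝ) =
        (j + 1) * ((l + 1 + j).choose l : ℝ) := by
      have := Nat.choose_mul_succ_eq (l + j) l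
      rw [show l + j + 1 - l = j + 1 by omega, show l + j + 1 = l + 1 + j by omega] at this
      have h2 : (((l + j).choose l * (l + 1 + j) : ℕ) : ℝ) =
        (((l + 1 + j).choose l * (j + 1) : ℕ) : ℝ) := by rw [this]
      push_cast at h2
      linarith
    rw [show j + 1 - 1 = j by omega]
    rcases l with _ | l
    · simp at hc ⊢
      ring_nf
    · rw [show l + 1 - 1 = l by omega]
      push_cast at hc ⊢
      linear_combination -(1 - Real.exp (-t)) ^ j * Real.exp (-t) ^ (l + 1) * hc

theorem continuous_yuleProb (n k l : ℕ) : Continuous fun t => yuleProb n t k l := by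
  unfold yuleProb
  split_ifs <;> fun_prop

theorem continuous_linearDeathProb (k l : ℕ) : Continuous fun t => linearDeathProb t k l := by
  unfold linearDeathProb
  split_ifs <;> fun_prop

theorem yuleProb_zero (n k l : ℕ) :
    yuleProb n 0 k l = if k = l then 1 else 0 := by
  unfold yuleProb
  rcases lt_trichotomy k l with h | rfl | h
  · simp [h.le, h.ne, Nat.sub_ne_zero_of_lt h]
  · simp
  · simp [h.not_ge, h.ne']

theorem linearDeathProb_zero (k l : ℕ) :
    linearDeathProb 0 k l = if k = l then 1 else 0 := by
  unfold linearDeathProb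
  rcases lt_trichotomy k l with h | rfl | h
  · simp [h.not_ge, h.ne]
  · simp
  · simp [h.le, h.ne', Nat.sub_ne_zero_of_lt h]

theorem yuleProb_nonneg (n : ℕ) {t : ℝ} (ht : 0 ≤ t) (k l : ℕ) : 0 ≤ yuleProb n t k l := by
  have : 0 ≤ 1 - Real.exp (-t) := by simpa using ht
  unfold yuleProb
  split_ifs <;> positivity

theorem linearDeathProb_nonneg {t : ℝ} (ht : 0 ≤ t) (k l : ℕ) : 0 ≤ linearDeathProb t k l := by
  have : 0 ≤ 1 - Real.exp (-t) := by simpa using ht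
  unfold linearDeathProb
  split_ifs <;> positivity

theorem hasSum_yuleProb {n : ℕ} (hn : 0 < n) {t : ℝ} (ht : 0 ≤ t) (k : ℕ) :
    HasSum (yuleProb n t k) 1 := by
  have h0 : 0 ≤ 1 - Real.exp (-t) := by simpa using ht
  have h1 : ‖1 - Real.exp (-t)‖ < 1 := by
    rw [Real.norm_eq_abs, abs_of_nonneg h0]
    linarith [Real.exp_pos (-t)]
  have h := (hasSum_choose_mul_geometric_of_norm_lt_one (k + n - 1) h1).mul_right
    (Real.exp (-t) ^ (k + n))
  have hinj : Function.Injective fun j : ℕ => j + k := fun i j h => by simpa using h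
  rw [← hinj.hasSum_iff]
  · have e1 : (1 : ℝ) = 1 / (1 - (1 - Real.exp (-t))) ^ (k + n - 1 + 1) *
        Real.exp (-t) ^ (k + n) := by
      rw [show k + n - 1 + 1 = k + n by omega, sub_sub_cancel, one_div,
        inv_mul_cancel₀ (pow_ne_zero _ (Real.exp_pos _).ne')]
    rw [e1]
    refine h.congr_fun fun j => ?_
    simp only [Function.comp, yuleProb, if_pos (show k ≤ j + k by omega)]
    rw [show j + k + n - 1 = j + (k + n - 1) by omega, show j + k - k = j by omega]
  · intro l hl
    refine if_neg fun hkl => hl ⟨l - k, ?_⟩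
    simp only
    omega

theorem linearDeathProb_eq_zero_of_lt {t : ℝ} {k l : ℕ} (h : k < l) :
    linearDeathProb t k l = 0 := if_neg (by omega)

theorem yuleProb_eq_zero_of_lt {n : ℕ} {t : ℝ} {k l : ℕ} (h : l < k) :
    yuleProb n t k l = 0 := if_neg (by omega)

theorem hasSum_linearDeathProb (t : ℝ) (k : ℕ) : HasSum (linearDeathProb t k) 1 := by
  have h : ∑ l ∈ Finset.range (k + 1), linearDeathProb t k l = 1 := by
    have := add_pow (Real.exp (-t)) (1 - Real.exp (-t)) k
    rw [add_sub_cancel, one_pow] at this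
    rw [this]
    refine Finset.sum_congr rfl fun l hl => ?_
    have hl : l ≤ k := by simpa [Nat.lt_succ_iff] using hl
    rw [linearDeathProb, if_pos hl, ← mul_neg, Real.exp_nat_mul]
    ring
  rw [← h]
  refine hasSum_sum_of_ne_finset_zero fun l hl => linearDeathProb_eq_zero_of_lt ?_
  simpa using hl

theorem hasTransitionRates_yuleProb {n : ℕ} (hn : 0 < n) :
    HasTransitionRates (yuleProb n) (yuleRate n) := by
  intro k l
  refine (hasDerivAt_yuleProb hn k l 0).hasDerivWithinAt.congr_deriv ?_
  rw [yuleProb_zero, yuleProb_zero, yuleRate]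
  split_ifs <;> first | omega | simp

theorem hasTransitionRates_linearDeathProb :
    HasTransitionRates linearDeathProb linearDeathRate := by
  intro k l
  refine (hasDerivAt_linearDeathProb k l 0).hasDerivWithinAt.congr_deriv ?_
  rw [linearDeathProb_zero, linearDeathProb_zero, linearDeathRate]
  split_ifs <;> first | omega | simp
  have : k = 0 := by omega
  simp [this]

theorem isTransitionSemigroup_yuleProb {n : ℕ} (hn : 0 < n) :
    IsTransitionSemigroup (yuleProb n) where
  nonneg t ht := yuleProb_nonneg n ht
  hasSum_one t ht := hasSum_yuleProb hn ht
  zero_self k := by rw [yuleProb_zero, if_pos rfl]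
  zero_ne k l h := by rw [yuleProb_zero, if_neg h]
  chapman_kolmogorov s t _ _ k l := by
    rcases lt_or_ge l k with h | h
    · rw [yuleProb_eq_zero_of_lt h]
      convert hasSum_zero using 2 with m
      rcases lt_or_ge m k with h1 | h1
      · rw [yuleProb_eq_zero_of_lt h1, zero_mul]
      · rw [yuleProb_eq_zero_of_lt (h.trans_le h1), mul_zero]
    obtain ⟨N, rfl⟩ := Nat.exists_eq_add_of_le h
    obtain ⟨n, rfl⟩ : ∃ m, n = m + 1 := ⟨n - 1, by omega⟩
    have hsum : ∑ j ∈ Finset.range (N + 1),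
        yuleProb (n + 1) s k (k + j) * yuleProb (n + 1) t (k + j) (k + N) =
        yuleProb (n + 1) (s + t) k (k + N) := by
      have h1 := add_pow ((1 - Real.exp (-s)) * Real.exp (-t)) (1 - Real.exp (-t)) N
      rw [show (1 - Real.exp (-s)) * Real.exp (-t) + (1 - Real.exp (-t)) =
        1 - Real.exp (-(s + t)) by rw [neg_add, Real.exp_add]; ring] at h1
      rw [yuleProb, if_pos h, Nat.add_sub_cancel_left, h1, neg_add, Real.exp_add, Finset.mul_sum,
        Finset.sum_mul]
      refine Finset.sum_congr rfl fun j hj => ?_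
      have hj : j ≤ N := by simpa [Nat.lt_succ_iff] using hj
      rw [yuleProb, yuleProb, if_pos (by omega), if_pos (by omega), Nat.add_sub_cancel_left,
        show k + N - (k + j) = N - j by omega, show k + j + (n + 1) - 1 = k + j + n by omega,
        show k + (n + 1) - 1 = k + n by omega, show k + N + (n + 1) - 1 = k + N + n by omega]
      have hc := Nat.choose_mul (n := k + N + n) (k := k + j + n) (s := k + n) (by omega)
      rw [show k + N + n - (k + n) = N by omega, show k + j + n - (k + n) = j by omega] at hc
      have hc' : ((k + N + n).choose (k + j + n) : ℝ) * (k + j + n).choose (k + n) =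
        (k + N + n).choose (k + n) * N.choose j := by exact_mod_cast hc
      rw [mul_pow]
      linear_combination (1 - Real.exp (-s)) ^ j * Real.exp (-s) ^ (k + (n + 1)) *
        (1 - Real.exp (-t)) ^ (N - j) * Real.exp (-t) ^ (k + j + (n + 1)) * hc'
    rw [← hsum]
    have hinj : Function.Injective fun j : ℕ => k + j := fun i j h => by simpa using h
    rw [← hinj.hasSum_iff]
    · refine hasSum_sum_of_ne_finset_zero fun j hj => ?_
      rw [Function.comp_apply, yuleProb_eq_zero_of_lt (k := k + j), mul_zero]
      rw [Finset.mem_range] at hj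
      omega
    · intro m hm
      rw [yuleProb_eq_zero_of_lt, zero_mul]
      by_contra hkm
      refine hm ⟨m - k, ?_⟩
      simp only
      omega

theorem isTransitionSemigroup_linearDeathProb : IsTransitionSemigroup linearDeathProb where
  nonneg t ht := linearDeathProb_nonneg ht
  hasSum_one t _ := hasSum_linearDeathProb t
  zero_self k := by rw [linearDeathProb_zero, if_pos rfl]
  zero_ne k l h := by rw [linearDeathProb_zero, if_neg h]
  chapman_kolmogorov s t _ _ k l := by
    rcases lt_or_ge k l with h | h
    · rw [linearDeathProb_eq_zero_of_lt h]
      convert hasSum_zero using 2 with m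
      rcases lt_or_ge k m with h1 | h1
      · rw [linearDeathProb_eq_zero_of_lt h1, zero_mul]
      · rw [linearDeathProb_eq_zero_of_lt (h1.trans_lt h), mul_zero]
    obtain ⟨N, rfl⟩ := Nat.exists_eq_add_of_le h
    have hsum : ∑ j ∈ Finset.range (N + 1),
        linearDeathProb s (l + N) (l + j) * linearDeathProb t (l + j) l =
        linearDeathProb (s + t) (l + N) l := by
      have h1 := add_pow (Real.exp (-s) * (1 - Real.exp (-t))) (1 - Real.exp (-s)) N
      rw [show Real.exp (-s) * (1 - Real.exp (-t)) + (1 - Real.exp (-s)) =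
        1 - Real.exp (-(s + t)) by rw [neg_add, Real.exp_add]; ring] at h1
      simp only [linearDeathProb, if_pos h, Nat.add_sub_cancel_left, h1, ← mul_neg,
        Real.exp_nat_mul, Finset.mul_sum]
      refine Finset.sum_congr rfl fun j hj => ?_
      have hj : j ≤ N := by simpa [Nat.lt_succ_iff] using hj
      rw [if_pos (by omega), if_pos (by omega), show l + N - (l + j) = N - j by omega, neg_add,
        Real.exp_add]
      have hc := Nat.choose_mul (n := l + N) (k := l + j) (s := l) (by omega)
      rw [show l + N - l = N by omega, show l + j - l = j by omega] at hc
      have hc' : ((l + N).choose (l + j) : ℝ) * (l + j).choose l =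
        (l + N).choose l * N.choose j := by exact_mod_cast hc
      rw [mul_pow (Real.exp (-s)) (1 - _)]
      linear_combination Real.exp (-s) ^ (l + j) * (1 - Real.exp (-s)) ^ (N - j) *
        Real.exp (-t) ^ l * (1 - Real.exp (-t)) ^ j * hc'
    rw [← hsum]
    have hinj : Function.Injective fun j : ℕ => l + j := fun i j h => by simpa using h
    rw [← hinj.hasSum_iff]
    · refine hasSum_sum_of_ne_finset_zero fun j hj => ?_
      rw [Function.comp_apply, linearDeathProb_eq_zero_of_lt (l := l + j), zero_mul]
      rw [Finset.mem_range] at hj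
      omega
    · intro m hm
      rw [linearDeathProb_eq_zero_of_lt (k := m), mul_zero]
      by_contra hkm
      refine hm ⟨m - l, ?_⟩
      simp only
      omega

end Explicit

/-! ### Lumping a Markov chain along a degree function -/

section Lumping

variable {Λ : Type*} {p : ℝ → Λ → Λ → ℝ} {q : Λ → Λ → ℝ}

theorem past_le {Ω S : Type*} [mΩ : MeasurableSpace Ω] {X : ℝ≥0 → Ω → S}
    (hX : ∀ t, Measurable[_, ⊤] (X t)) (s : ℝ≥0) : past X s ≤ mΩ :=
  iSup_le fun u => (hX u).comap_le

/-- If the probability of moving from `a` to the level `{deg = l}` depends on `a` only through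
`deg a`, then the degree of the chain is a Markov chain. -/
theorem IsMarkovChain.map_deg {Ω : Type*} [MeasurableSpace Ω] {μ : Measure Ω}
    [IsProbabilityMeasure μ] {X : ℝ≥0 → Ω → Λ} (hX : IsMarkovChain μ X p q)
    {deg : Λ → ℕ} (hfin : ∀ m, {a | deg a = m}.Finite) {P : ℝ → ℕ → ℕ → ℝ} {Q : ℕ → ℕ → ℝ}
    (hP : IsTransitionSemigroup P) (hQ : HasTransitionRates P Q)
    (hlump : ∀ t, 0 ≤ t → ∀ a l, ∑ b ∈ (hfin l).toFinset, p t a b = P t (deg a) l) :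
    IsMarkovChain μ (fun t ω => deg (X t ω)) P Q where
  semigroup := hP
  rates := hQ
  measurable t := measurable_from_top.comp (hX.measurable t)
  markov s t l := by
    set Y : ℝ≥0 → Ω → ℕ := fun t ω => deg (X t ω) with hY
    have hYm : ∀ t, Measurable[_, ⊤] (Y t) := fun t => measurable_from_top.comp (hX.measurable t)
    have hle : past Y s ≤ past X s := by
      refine iSup_mono fun u => ?_
      rw [show Y u = deg ∘ X u from rfl, ← MeasurableSpace.comap_comp]
      exact MeasurableSpace.comap_mono le_top
    have hind : (Y (s + t) ⁻¹' {l}).indicator (fun _ => (1 : ℝ)) =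
        ∑ b ∈ (hfin l).toFinset, (X (s + t) ⁻¹' {b}).indicator (fun _ => (1 : ℝ)) := by
      classical
      ext ω
      simp [Set.indicator_apply, Finset.sum_apply, hY]
    have hint : ∀ b, Integrable ((X (s + t) ⁻¹' {b}).indicator (fun _ => (1 : ℝ))) μ := fun b =>
      (integrable_const _).indicator (hX.measurable _ trivial)
    have h1 : μ[(Y (s + t) ⁻¹' {l}).indicator (fun _ => (1 : ℝ)) | past X s]
        =ᵐ[μ] fun ω => P t (Y s ω) l := by
      rw [hind]
      refine (condExp_finsetSum (fun b _ => hint b) _).trans ?_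
      have : ∀ᵐ ω ∂μ, ∀ b ∈ (hfin l).toFinset,
          (μ[(X (s + t) ⁻¹' {b}).indicator (fun _ => (1 : ℝ)) | past X s]) ω = p t (X s ω) b := by
        rw [Filter.eventually_all_finset]
        exact fun b _ => hX.markov s t b
      filter_upwards [this] with ω hω
      rw [Finset.sum_apply, Finset.sum_congr rfl hω, hlump t t.2]
    refine (condExp_condExp_of_le hle (past_le hX.measurable s)).symm.trans ?_
    refine (condExp_congr_ae h1).trans ?_
    have hsm : StronglyMeasurable[past Y s] fun ω => P t (Y s ω) l := by
      have hYs : Measurable[past Y s, ⊤] (Y s) :=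
        (comap_measurable (Y s)).mono
          (le_iSup (fun u : Set.Iic s => MeasurableSpace.comap (Y u) ⊤) ⟨s, le_refl s⟩) le_rfl
      exact (measurable_from_top (f := fun k => P t k l)).stronglyMeasurable.comp_measurable hYs
    rw [condExp_of_stronglyMeasurable (past_le hYm s) hsm]
    refine Integrable.of_bound (hsm.mono (past_le hYm s)).aestronglyMeasurable 1
      (Filter.Eventually.of_forall fun ω => ?_)
    rw [Real.norm_eq_abs, abs_of_nonneg (hP.nonneg t t.2 _ _)]
    exact hP.le_one t.2 _ _

/-- The backward equation summed over a level. -/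
theorem hasDerivWithinAt_sum_backward (hp : IsTransitionSemigroup p)
    (hq : HasTransitionRates p q) (a : Λ) (F : Finset Λ) (r : Λ → ℝ) (s : Finset Λ) (c : ℝ)
    (has : a ∉ s) (hqa : q a a = -c) (hqs : ∀ b ∈ s, q a b = r b) (hsum : ∑ b ∈ s, r b = c)
    {t : ℝ} (ht : 0 ≤ t) :
    HasDerivWithinAt (fun u => ∑ b ∈ F, p u a b)
      (∑ b ∈ s, r b * ∑ l ∈ F, p t b l - c * ∑ b ∈ F, p t a b) (Set.Ici t) t := by
  classical
  have h := HasDerivWithinAt.fun_sum (u := F) fun b _ =>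
    hasDerivWithinAt_backward hp hq a b (insert a s) (Finset.mem_insert_self a s)
      (by rw [Finset.sum_insert has, hqa, Finset.sum_congr rfl hqs, hsum, neg_add_cancel]) ht
  refine h.congr_deriv ?_
  have h2 : ∑ b ∈ s, ∑ l ∈ F, q a b * p t b l = ∑ b ∈ s, r b * ∑ l ∈ F, p t b l :=
    Finset.sum_congr rfl fun b hb => by rw [hqs b hb, ← Finset.mul_sum]
  rw [Finset.sum_comm, Finset.sum_insert has, h2, hqa, ← Finset.mul_sum]
  ring

theorem continuousOn_sum (hp : IsTransitionSemigroup p) (hq : HasTransitionRates p q) (a : Λ)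
    (F : Finset Λ) : ContinuousOn (fun u => ∑ b ∈ F, p u a b) (Set.Ici 0) :=
  continuousOn_finsetSum _ fun b _ => continuousOn_of_hasTransitionRates hp hq a b

variable {deg : Λ → ℕ}

theorem sum_level_zero (hp : IsTransitionSemigroup p) (hfin : ∀ m, {a | deg a = m}.Finite)
    (a : Λ) (l : ℕ) : ∑ b ∈ (hfin l).toFinset, p 0 a b = if deg a = l then 1 else 0 := by
  classical
  have h : ∀ b, p 0 a b = if a = b then 1 else 0 := fun b => by
    split_ifs with h
    · rw [← h, hp.zero_self]
    · exact hp.zero_ne a b h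
  simp [h]

/-- Lumping a chain that jumps from `a` to the next level at total rate `n + deg a`. Uniqueness
for the lumped backward equations holds because `(n + k) eᵗ` is a solution of the Yule backward
equations which is unbounded in `k` (so the process does not explode). -/
theorem sum_level_eq_yuleProb {n : ℕ} (hn : 0 < n) (hp : IsTransitionSemigroup p)
    (hq : HasTransitionRates p q) (hfin : ∀ m, {a | deg a = m}.Finite)
    (hdiag : ∀ a, q a a = -((n : ℝ) + deg a))
    (hnonneg : ∀ a b, deg b = deg a + 1 → 0 ≤ q a b)
    (hsum : ∀ a, ∑ b ∈ (hfin (deg a + 1)).toFinset, q a b = (n : ℝ) + deg a)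
    (t : ℝ) (ht : 0 ≤ t) (a : Λ) (l : ℕ) :
    ∑ b ∈ (hfin l).toFinset, p t a b = yuleProb n t (deg a) l := by
  set u : Λ → ℝ → ℝ := fun a t => ∑ b ∈ (hfin l).toFinset, p t a b - yuleProb n t (deg a) l
    with hu
  have hcont : ∀ a, ContinuousOn (u a) (Set.Ici 0) := fun a =>
    (continuousOn_sum hp hq a _).sub (continuous_yuleProb n _ l).continuousOn
  have hu0 : ∀ a, u a 0 = 0 := fun a => by
    simp only [hu, sum_level_zero hp hfin, yuleProb_zero, sub_self]
  have hderiv : ∀ a t, 0 ≤ t → HasDerivWithinAt (u a)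
      (∑ b ∈ (hfin (deg a + 1)).toFinset, q a b * u b t - ((n : ℝ) + deg a) * u a t)
      (Set.Ici t) t := fun a t ht => by
    have h1 := hasDerivWithinAt_sum_backward hp hq a (hfin l).toFinset (q a)
      (hfin (deg a + 1)).toFinset _ (by simp) (hdiag a) (fun _ _ => rfl) (hsum a) ht
    refine (h1.fun_sub (hasDerivAt_yuleProb hn (deg a) l t).hasDerivWithinAt).congr_deriv ?_
    have h2 : ∑ b ∈ (hfin (deg a + 1)).toFinset, q a b * u b t =
        ∑ b ∈ (hfin (deg a + 1)).toFinset, q a b * ∑ l ∈ (hfin l).toFinset, p t b l -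
          ((n : ℝ) + deg a) * yuleProb n t (deg a + 1) l := by
      rw [← hsum a, Finset.sum_mul, ← Finset.sum_sub_distrib]
      refine Finset.sum_congr rfl fun b hb => ?_
      have hb : deg b = deg a + 1 := by simpa using hb
      simp only [hu, hb]
      ring
    rw [h2]
    simp only [hu]
    ring
  have hn' : (0 : ℝ) < n := by exact_mod_cast hn
  -- on the level `M` the trivial bound `1` holds; it propagates down to lower levels, where it
  -- becomes small because `(n + deg a) / (n + M)` does
  have hbound : ∀ M j : ℕ, ∀ a, deg a + j = M → ∀ t, 0 ≤ t →
      |u a t| ≤ ((n : ℝ) + deg a) / (n + M) * Real.exp t := by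
    intro M j
    induction j with
    | zero =>
      intro a ha t ht
      rw [← ha, add_zero, div_self (by positivity), one_mul]
      refine le_trans ?_ (Real.one_le_exp ht)
      have h1 := hp.sum_le_one ht a (hfin l).toFinset
      have h2 := Finset.sum_nonneg fun b (_ : b ∈ (hfin l).toFinset) => hp.nonneg t ht a b
      have h3 := yuleProb_nonneg n ht (deg a) l
      have h4 := (isTransitionSemigroup_yuleProb hn).le_one ht (deg a) l
      rw [abs_le]
      constructor <;> simp only [hu] <;> linarith
    | succ j ih =>
      intro a ha t ht
      refine abs_le_of_hasDerivWithinAt_sub (B' := fun s =>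
        ((n : ℝ) + deg a) / (n + M) * Real.exp s) (hcont a) (hderiv a) (hu0 a) (by positivity)
        (fun s => (Real.hasDerivAt_exp s).const_mul _) (fun s hs => ?_) ht
      refine (Finset.abs_sum_le_sum_abs _ _).trans ?_
      calc ∑ b ∈ (hfin (deg a + 1)).toFinset, |q a b * u b s|
          ≤ ∑ b ∈ (hfin (deg a + 1)).toFinset,
              q a b * (((n : ℝ) + (deg a + 1)) / (n + M) * Real.exp s) := by
            refine Finset.sum_le_sum fun b hb => ?_
            have hb : deg b = deg a + 1 := by simpa using hb
            rw [abs_mul, abs_of_nonneg (hnonneg a b hb)]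
            refine mul_le_mul_of_nonneg_left ?_ (hnonneg a b hb)
            have := ih b (by omega) s hs
            rwa [hb, Nat.cast_add, Nat.cast_one] at this
        _ = _ := by
            rw [← Finset.sum_mul, hsum]
            ring
  have hlim : Filter.Tendsto (fun M : ℕ => ((n : ℝ) + deg a) / (n + M) * Real.exp t)
      Filter.atTop (nhds 0) := by
    have h1 : Filter.Tendsto (fun M : ℕ => (n : ℝ) + M) Filter.atTop Filter.atTop :=
      Filter.tendsto_atTop_add_const_left _ _ tendsto_natCast_atTop_atTop
    simpa using (h1.const_div_atTop ((n : ℝ) + deg a)).mul_const (Real.exp t)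
  have h0 : |u a t| ≤ 0 := by
    refine ge_of_tendsto hlim ?_
    filter_upwards [Filter.eventually_ge_atTop (deg a)] with M hM
    exact hbound M (M - deg a) a (by omega) t ht
  exact sub_eq_zero.1 (abs_nonpos_iff.1 h0)

/-- Lumping a chain that jumps from `a` to the previous level at total rate `deg a`; the lumped
backward equations are solved by induction on the degree. -/
theorem sum_level_eq_linearDeathProb (hp : IsTransitionSemigroup p)
    (hq : HasTransitionRates p q) (hfin : ∀ m, {a | deg a = m}.Finite)
    (hdiag : ∀ a, q a a = -(deg a : ℝ))
    (hsum : ∀ a m, deg a = m + 1 → ∑ b ∈ (hfin m).toFinset, q a b = deg a)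
    (t : ℝ) (ht : 0 ≤ t) (a : Λ) (l : ℕ) :
    ∑ b ∈ (hfin l).toFinset, p t a b = linearDeathProb t (deg a) l := by
  set u : Λ → ℝ → ℝ := fun a t => ∑ b ∈ (hfin l).toFinset, p t a b - linearDeathProb t (deg a) l
    with hu
  have hcont : ∀ a, ContinuousOn (u a) (Set.Ici 0) := fun a =>
    (continuousOn_sum hp hq a _).sub (continuous_linearDeathProb _ l).continuousOn
  have hu0 : ∀ a, u a 0 = 0 := fun a => by
    simp only [hu, sum_level_zero hp hfin, linearDeathProb_zero, sub_self]
  have hzero : ∀ k, ∀ a, deg a = k → ∀ t, 0 ≤ t → |u a t| ≤ 0 := by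
    intro k
    induction k with
    | zero =>
      intro a ha t ht
      refine abs_le_of_hasDerivWithinAt_sub (r := 0) (ρ := fun _ => 0) (B := fun _ => 0)
        (B' := fun _ => 0) (hcont a) (fun s hs => ?_) (hu0 a) le_rfl
        (fun s => hasDerivAt_const s 0) (fun s _ => by simp) ht
      have h1 := hasDerivWithinAt_sum_backward hp hq a (hfin l).toFinset (fun _ => 0) ∅ 0
        (by simp) (by simp [hdiag, ha]) (by simp) (by simp) hs
      refine (h1.fun_sub (hasDerivAt_linearDeathProb (deg a) l s).hasDerivWithinAt).congr_deriv ?_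
      simp [ha]
    | succ m ih =>
      intro a ha t ht
      refine abs_le_of_hasDerivWithinAt_sub (r := deg a) (ρ := fun _ => 0) (B := fun _ => 0)
        (B' := fun _ => 0) (hcont a) (fun s hs => ?_) (hu0 a) le_rfl
        (fun s => hasDerivAt_const s 0) (fun s _ => by simp) ht
      have h1 := hasDerivWithinAt_sum_backward hp hq a (hfin l).toFinset (q a)
        (hfin m).toFinset _ (by simp [ha]) (hdiag a) (fun _ _ => rfl) (hsum a m ha) hs
      refine (h1.fun_sub (hasDerivAt_linearDeathProb (deg a) l s).hasDerivWithinAt).congr_deriv ?_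
      have h2 : ∑ b ∈ (hfin m).toFinset, q a b * ∑ l ∈ (hfin l).toFinset, p s b l =
          (deg a : ℝ) * linearDeathProb s (deg a - 1) l := by
        rw [← hsum a m ha, Finset.sum_mul]
        refine Finset.sum_congr rfl fun b hb => ?_
        have hb : deg b = m := by simpa using hb
        have := sub_eq_zero.1 (abs_nonpos_iff.1 (ih b hb s hs))
        rw [this, hb, ha, Nat.add_sub_cancel]
      rw [h2]
      simp only [hu]
      ring
  exact sub_eq_zero.1 (abs_nonpos_iff.1 (hzero _ a rfl t ht))

end Lumping

/-! ### The Fock inner product on functions of subgaussian growth -/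

section FockFunctions

variable {V : Type*} [NormedAddCommGroup V] [InnerProductSpace ℂ V]

/-- The algebra of continuous functions `f` with `f = O(exp (ε ‖z‖²))` for every `ε > 0`. It
contains the polynomials in `z` and `conj z`, and the Fock inner product is sesquilinear on it
because all integrals involved converge. -/
def subgaussian (V : Type*) [NormedAddCommGroup V] [InnerProductSpace ℂ V] :
    Subalgebra ℂ (V → ℂ) where
  carrier := {f | Continuous f ∧ ∀ ε : ℝ, 0 < ε → ∃ C, ∀ z, ‖f z‖ ≤ C * Real.exp (ε * ‖z‖ ^ 2)}
  mul_mem' := by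
    rintro f g ⟨hf, hf'⟩ ⟨hg, hg'⟩
    refine ⟨hf.mul hg, fun ε hε => ?_⟩
    obtain ⟨C, hC⟩ := hf' (ε / 2) (half_pos hε)
    obtain ⟨D, hD⟩ := hg' (ε / 2) (half_pos hε)
    refine ⟨C * D, fun z => ?_⟩
    rw [Pi.mul_apply, norm_mul]
    refine (mul_le_mul (hC z) (hD z) (norm_nonneg _) ((norm_nonneg _).trans (hC z))).trans_eq ?_
    rw [mul_mul_mul_comm, ← Real.exp_add, ← add_mul, add_halves]
  add_mem' := by
    rintro f g ⟨hf, hf'⟩ ⟨hg, hg'⟩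
    refine ⟨hf.add hg, fun ε hε => ?_⟩
    obtain ⟨C, hC⟩ := hf' ε hε
    obtain ⟨D, hD⟩ := hg' ε hε
    refine ⟨C + D, fun z => ?_⟩
    rw [add_mul]
    exact (norm_add_le _ _).trans (add_le_add (hC z) (hD z))
  algebraMap_mem' c := by
    refine ⟨continuous_const, fun ε hε => ⟨‖c‖, fun z => ?_⟩⟩
    exact le_mul_of_one_le_right (norm_nonneg _) (Real.one_le_exp (by positivity))

theorem conj_mem_subgaussian {f : V → ℂ} (hf : f ∈ subgaussian V) :
    (fun z => conj (f z)) ∈ subgaussian V :=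
  ⟨Complex.continuous_conj.comp hf.1, fun ε hε => by simpa using hf.2 ε hε⟩

theorem holPoly_le_subgaussian [FiniteDimensional ℂ V] : holPoly V ≤ subgaussian V := by
  refine Algebra.adjoin_le ?_
  rintro _ ⟨l, rfl⟩
  have hl : Continuous l := l.continuous_of_finiteDimensional
  refine ⟨hl, fun ε hε => ?_⟩
  obtain ⟨C, hC0, hC⟩ := (LinearMap.toContinuousLinearMap l).bound
  refine ⟨C * (1 + 1 / ε), fun z => (hC z).trans ?_⟩
  rw [mul_assoc]
  refine mul_le_mul_of_nonneg_left ?_ hC0.le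
  have h1 : ε * ‖z‖ ^ 2 + 1 ≤ Real.exp (ε * ‖z‖ ^ 2) := Real.add_one_le_exp _
  have h2 : ‖z‖ ≤ (1 + 1 / ε) * (ε * ‖z‖ ^ 2 + 1) := by
    have h3 : (1 + 1 / ε) * (ε * ‖z‖ ^ 2 + 1) = ε * ‖z‖ ^ 2 + ‖z‖ ^ 2 + 1 + 1 / ε := by
      field_simp
      ring
    rw [h3]
    have : 0 < 1 / ε := by positivity
    nlinarith [sq_nonneg (‖z‖ - 1), mul_nonneg hε.le (sq_nonneg ‖z‖)]
  exact h2.trans (mul_le_mul_of_nonneg_left h1 (by positivity))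

theorem hasLineDerivAt_exp_neg_sq_norm (v z : V) :
    HasLineDerivAt ℝ (fun z : V => (Real.exp (-‖z‖ ^ 2) : ℂ))
      (-(2 * (inner ℂ z v).re) * Real.exp (-‖z‖ ^ 2) : ℝ) z v := by
  unfold HasLineDerivAt
  refine HasDerivAt.ofReal_comp ?_
  have h : ∀ t : ℝ, ‖z + t • v‖ ^ 2 = ‖z‖ ^ 2 + 2 * t * (inner ℂ z v).re + t ^ 2 * ‖v‖ ^ 2 :=
    fun t => by
      rw [norm_add_sq (𝕜 := ℂ), ← Complex.coe_smul, inner_smul_right, norm_smul, mul_pow]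
      simp
      ring
  simp only [h]
  have hd : HasDerivAt (fun t : ℝ =>
      -(‖z‖ ^ 2 + 2 * t * (inner ℂ z v).re + t ^ 2 * ‖v‖ ^ 2)) (-(2 * (inner ℂ z v).re)) 0 := by
    have h1 := ((((hasDerivAt_id (0 : ℝ)).const_mul 2).mul_const (inner ℂ z v).re).const_add
      (‖z‖ ^ 2)).fun_add (((hasDerivAt_id (0 : ℝ)).fun_pow 2).mul_const (‖v‖ ^ 2))
    simpa using h1.fun_neg
  refine hd.exp.congr_deriv ?_
  simp [mul_comm]

variable [FiniteDimensional ℂ V] [MeasurableSpace V] [BorelSpace V]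

instance : (lebesgue V).IsAddHaarMeasure := by
  unfold lebesgue
  let : InnerProductSpace ℝ V := InnerProductSpace.complexToReal
  infer_instance

theorem integrable_exp_neg_mul_sq_norm {c : ℝ} (hc : 0 < c) :
    Integrable (fun z : V => Real.exp (-c * ‖z‖ ^ 2)) (lebesgue V) := by
  unfold lebesgue
  let : InnerProductSpace ℝ V := InnerProductSpace.complexToReal
  have h := (GaussianFourier.integrable_cexp_neg_mul_sq_norm_add (V := V) (b := (c : ℂ))
    (by simpa using hc) 0 0).norm
  refine h.congr (Filter.Eventually.of_forall fun z => ?_)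
  simp only [zero_mul, add_zero, Complex.norm_exp]
  norm_cast

theorem integrable_subgaussian_mul {f : V → ℂ} (hf : f ∈ subgaussian V) :
    Integrable (fun z => f z * (Real.exp (-‖z‖ ^ 2) : ℂ)) (lebesgue V) := by
  obtain ⟨C, hC⟩ := hf.2 (1 / 2) (by norm_num)
  refine Integrable.mono' ((integrable_exp_neg_mul_sq_norm (V := V)
    (show (0 : ℝ) < 1 / 2 by norm_num)).const_mul C) ?_ (Filter.Eventually.of_forall fun z => ?_)
  · have := hf.1
    exact Continuous.aestronglyMeasurable (by fun_prop)
  · rw [norm_mul, Complex.norm_real, Real.norm_eq_abs, abs_of_pos (Real.exp_pos _)]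
    refine (mul_le_mul_of_nonneg_right (hC z) (Real.exp_pos _).le).trans_eq ?_
    rw [mul_assoc, ← Real.exp_add]
    ring_nf

theorem integrable_fock {f g : V → ℂ} (hf : f ∈ subgaussian V) (hg : g ∈ subgaussian V) :
    Integrable (fun z => f z * conj (g z) * (Real.exp (-‖z‖ ^ 2) : ℂ)) (lebesgue V) :=
  integrable_subgaussian_mul (mul_mem hf (conj_mem_subgaussian hg))

theorem fock_add_left {f₁ f₂ g : V → ℂ} (h₁ : f₁ ∈ subgaussian V) (h₂ : f₂ ∈ subgaussian V)
    (hg : g ∈ subgaussian V) : fock (f₁ + f₂) g = fock f₁ g + fock f₂ g := by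
  simp only [fock, ← mul_add, Pi.add_apply, add_mul]
  rw [integral_add (integrable_fock h₁ hg) (integrable_fock h₂ hg)]

theorem fock_smul_left (c : ℂ) (f g : V → ℂ) : fock (c • f) g = c * fock f g := by
  simp only [fock, Pi.smul_apply, smul_eq_mul, mul_assoc]
  rw [integral_const_mul]
  ring

theorem fock_conj_symm (f g : V → ℂ) : conj (fock f g) = fock g f := by
  simp only [fock, map_mul, Complex.conj_ofReal]
  rw [← integral_conj]
  congr 2
  ext z
  simp only [map_mul, Complex.conj_conj, Complex.conj_ofReal]
  ring

theorem fock_add_right {f g₁ g₂ : V → ℂ} (hf : f ∈ subgaussian V) (h₁ : g₁ ∈ subgaussian V)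
    (h₂ : g₂ ∈ subgaussian V) : fock f (g₁ + g₂) = fock f g₁ + fock f g₂ := by
  rw [← fock_conj_symm, fock_add_left h₁ h₂ hf, map_add, fock_conj_symm, fock_conj_symm]

theorem fock_smul_right (c : ℂ) (f g : V → ℂ) : fock f (c • g) = conj c * fock f g := by
  rw [← fock_conj_symm, fock_smul_left, map_mul, fock_conj_symm]

theorem fock_zero_left (g : V → ℂ) : fock 0 g = 0 := by
  simpa using fock_smul_left 0 0 g

theorem fock_sum_left {ι : Type*} (s : Finset ι) {f : ι → V → ℂ} {g : V → ℂ}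
    (hf : ∀ i ∈ s, f i ∈ subgaussian V) (hg : g ∈ subgaussian V) :
    fock (∑ i ∈ s, f i) g = ∑ i ∈ s, fock (f i) g := by
  classical
  induction s using Finset.induction_on with
  | empty => simpa using fock_zero_left g
  | insert a s ha ih =>
    have h := fun i hi => hf i (Finset.mem_insert_of_mem hi)
    rw [Finset.sum_insert ha, Finset.sum_insert ha,
      fock_add_left (hf a (Finset.mem_insert_self a s)) (sum_mem h) hg, ih h]

theorem fock_one_one : fock (1 : V → ℂ) 1 = 1 := by
  have h : ∫ z : V, Real.exp (-‖z‖ ^ 2) ∂(lebesgue V) = Real.pi ^ Module.finrank ℂ V := by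
    unfold lebesgue
    let : InnerProductSpace ℝ V := InnerProductSpace.complexToReal
    have h := GaussianFourier.integral_rexp_neg_mul_sq_norm (V := V) (b := 1) one_pos
    have h2 : Module.finrank ℝ V = 2 * Module.finrank ℂ V := finrank_real_of_complex V
    rw [h2] at h
    simp only [neg_one_mul, div_one, Nat.cast_mul, Nat.cast_ofNat] at h
    rw [h, mul_div_cancel_left₀ _ two_ne_zero, Real.rpow_natCast]
  simp only [fock, Pi.one_apply, map_one, one_mul]
  rw [integral_complex_ofReal, h, ← Complex.ofReal_mul, ← mul_pow, one_div,
    inv_mul_cancel₀ Real.pi_ne_zero, one_pow, Complex.ofReal_one]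

theorem measurePreserving_lebesgue (k : V ≃ₗᵢ[ℂ] V) :
    MeasurePreserving k (lebesgue V) (lebesgue V) := by
  unfold lebesgue
  let : InnerProductSpace ℝ V := InnerProductSpace.complexToReal
  let k' : V ≃ₗᵢ[ℝ] V :=
    { k.toLinearEquiv.restrictScalars ℝ with norm_map' := k.norm_map }
  exact k'.measurePreserving

theorem fock_comp (k : V ≃ₗᵢ[ℂ] V) (f g : V → ℂ) : fock (f ∘ k) (g ∘ k) = fock f g := by
  simp only [fock]
  congr 1
  have h := (measurePreserving_lebesgue k).integral_comp k.toHomeomorph.measurableEmbedding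
    fun z => f z * conj (g z) * (Real.exp (-‖z‖ ^ 2) : ℂ)
  simpa using h

theorem fock_mul_conj (f g : V → ℂ) : fock (f * fun z => conj (g z)) 1 = fock f g := by
  simp [fock]

end FockFunctions

/-! ### Coordinates -/

section Coordinates

variable {V : Type*} [NormedAddCommGroup V] [InnerProductSpace ℂ V] [FiniteDimensional ℂ V]

/-- Polynomials in `dim V` variables, viewed as functions on `V` through the coordinates of an
orthonormal basis. -/
def evalPoly (V : Type*) [NormedAddCommGroup V] [InnerProductSpace ℂ V] [FiniteDimensional ℂ V] :
    MvPolynomial (Fin (Module.finrank ℂ V)) ℂ →ₐ[ℂ] (V → ℂ) :=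
  MvPolynomial.aeval fun i z => (stdOrthonormalBasis ℂ V).repr z i

theorem evalPoly_X (i : Fin (Module.finrank ℂ V)) (z : V) :
    evalPoly V (MvPolynomial.X i) z = (stdOrthonormalBasis ℂ V).repr z i := by
  simp [evalPoly]

theorem evalPoly_apply (F : MvPolynomial (Fin (Module.finrank ℂ V)) ℂ) (z : V) :
    evalPoly V F z = MvPolynomial.eval (fun i => (stdOrthonormalBasis ℂ V).repr z i) F := by
  induction F using MvPolynomial.induction_on with
  | C a => simp [evalPoly]
  | add p q hp hq => rw [map_add, map_add, Pi.add_apply, hp, hq]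
  | mul_X p i hp => rw [map_mul, map_mul, Pi.mul_apply, hp, evalPoly_X, MvPolynomial.eval_X]

theorem evalPoly_injective : Function.Injective (evalPoly V) := by
  intro F G h
  refine MvPolynomial.funext fun x => ?_
  have := congrFun h ((stdOrthonormalBasis ℂ V).repr.symm (WithLp.toLp 2 x))
  simpa [evalPoly_apply] using this

theorem range_evalPoly : (evalPoly V).range = holPoly V := by
  apply le_antisymm
  · rintro _ ⟨F, rfl⟩
    change evalPoly V F ∈ holPoly V
    induction F using MvPolynomial.induction_on with
    | C a =>
      rw [← MvPolynomial.algebraMap_eq, AlgHom.commutes]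
      exact Subalgebra.algebraMap_mem _ _
    | add p q hp hq =>
      rw [map_add]
      exact add_mem hp hq
    | mul_X p i hp =>
      rw [map_mul]
      refine mul_mem hp (Algebra.subset_adjoin ⟨(EuclideanSpace.proj i : _ →L[ℂ] ℂ).toLinearMap ∘ₗ
        ((stdOrthonormalBasis ℂ V).repr.toLinearEquiv : V →ₗ[ℂ] _), ?_⟩)
      ext z
      rw [evalPoly_X]
      rfl
  · refine Algebra.adjoin_le ?_
    rintro _ ⟨l, rfl⟩
    refine ⟨∑ i, MvPolynomial.C (l (stdOrthonormalBasis ℂ V i)) * MvPolynomial.X i, ?_⟩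
    ext z
    conv_rhs => rw [← (stdOrthonormalBasis ℂ V).sum_repr z, map_sum]
    change evalPoly V _ z = _
    rw [evalPoly_apply]
    simp [mul_comm]

theorem evalPoly_mem_holPoly (F : MvPolynomial (Fin (Module.finrank ℂ V)) ℂ) :
    evalPoly V F ∈ holPoly V := by
  rw [← range_evalPoly]
  exact ⟨F, rfl⟩

theorem evalPoly_mem_subgaussian (F : MvPolynomial (Fin (Module.finrank ℂ V)) ℂ) :
    evalPoly V F ∈ subgaussian V := holPoly_le_subgaussian (evalPoly_mem_holPoly F)

/-- The derivative of a polynomial in the real direction `c • e_i`, for a complex number `c`. -/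
theorem hasLineDerivAt_evalPoly (F : MvPolynomial (Fin (Module.finrank ℂ V)) ℂ)
    (i : Fin (Module.finrank ℂ V)) (c : ℂ) (z : V) :
    HasLineDerivAt ℝ (evalPoly V F) (c * evalPoly V (MvPolynomial.pderiv i F) z) z
      (c • stdOrthonormalBasis ℂ V i) := by
  unfold HasLineDerivAt
  induction F using MvPolynomial.induction_on with
  | C a =>
    rw [MvPolynomial.pderiv_C, map_zero, Pi.zero_apply, mul_zero]
    simpa [evalPoly_apply] using hasDerivAt_const (0 : ℝ) a
  | add p q hp hq =>
    rw [map_add, map_add, map_add, Pi.add_apply, mul_add]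
    exact hp.fun_add hq
  | mul_X p j hp =>
    have hX : HasDerivAt (fun t : ℝ => evalPoly V (MvPolynomial.X j)
        (z + t • c • stdOrthonormalBasis ℂ V i)) (if i = j then c else 0) 0 := by
      have h : ∀ t : ℝ, evalPoly V (MvPolynomial.X j) (z + t • c • stdOrthonormalBasis ℂ V i) =
          (stdOrthonormalBasis ℂ V).repr z j + (t : ℂ) * (if i = j then c else 0) := fun t => by
        rw [evalPoly_X, map_add, ← Complex.coe_smul, map_smul, map_smul,
          OrthonormalBasis.repr_self]
        simp only [PiLp.add_apply, PiLp.smul_apply, smul_eq_mul, PiLp.single_apply]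
        simp [eq_comm]
      simp only [h]
      have := ((hasDerivAt_id (0 : ℝ)).ofReal_comp.mul_const (if i = j then c else 0)).const_add
        ((stdOrthonormalBasis ℂ V).repr z j)
      simpa using this
    rw [map_mul]
    refine (hp.fun_mul hX).congr_deriv ?_
    rw [Derivation.leibniz, map_add, smul_eq_mul, smul_eq_mul, MvPolynomial.pderiv_X, map_mul,
      map_mul, Pi.add_apply, Pi.mul_apply, Pi.mul_apply, zero_smul, add_zero]
    by_cases h : i = j
    · subst h
      simp
      ring
    · simp [h]
      ring

variable [MeasurableSpace V] [BorelSpace V]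

theorem integral_hasLineDerivAt_eq_zero {f f' : V → ℂ} {v : V}
    (hf : Integrable f (lebesgue V)) (hf' : Integrable f' (lebesgue V))
    (h : ∀ z, HasLineDerivAt ℝ f (f' z) z v) : ∫ z, f' z ∂(lebesgue V) = 0 := by
  have : FiniteDimensional ℝ V := FiniteDimensional.complexToReal V
  have := integral_bilinear_hasLineDerivAt_right_eq_neg_left_of_integrable (μ := lebesgue V)
    (B := ContinuousLinearMap.mul ℝ ℂ) (f := fun _ => 1) (f' := fun _ => 0) (g := f) (g' := f')
    (v := v) (by simp) (by simpa using hf') (by simpa using hf)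
    (fun z _ => hasDerivAt_const (0 : ℝ) (1 : ℂ)) (fun z _ => h z)
  simpa using this

/-- In the Fock inner product, multiplication by a coordinate is adjoint to the corresponding
partial derivative: integrate the holomorphic derivative `(∂_x - i ∂_y)/2` of
`F * conj G * exp(-‖z‖²)`. -/
theorem fock_pderiv (F G : MvPolynomial (Fin (Module.finrank ℂ V)) ℂ)
    (i : Fin (Module.finrank ℂ V)) :
    fock (evalPoly V (MvPolynomial.pderiv i F)) (evalPoly V G) =
      fock (evalPoly V F) (evalPoly V (MvPolynomial.X i * G)) := by
  set b := stdOrthonormalBasis ℂ V with hb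
  have hF := evalPoly_mem_subgaussian (V := V) F
  have hG := evalPoly_mem_subgaussian (V := V) G
  have hF' := evalPoly_mem_subgaussian (V := V) (MvPolynomial.pderiv i F)
  have hG' := evalPoly_mem_subgaussian (V := V) (MvPolynomial.pderiv i G)
  have hX := evalPoly_mem_subgaussian (V := V) (MvPolynomial.X i)
  have hXG := evalPoly_mem_subgaussian (V := V) (MvPolynomial.X i * G)
  have m1 := mul_mem hF' (conj_mem_subgaussian hG)
  have m2 := mul_mem hF (conj_mem_subgaussian hG')
  have m3 := mul_mem hF (conj_mem_subgaussian hXG)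
  have m4 := mul_mem (mul_mem hX hF) (conj_mem_subgaussian hG)
  have key : ∀ c : ℂ, fock (c • (evalPoly V (MvPolynomial.pderiv i F) *
      fun z => conj (evalPoly V G z)) + conj c • (evalPoly V F *
      fun z => conj (evalPoly V (MvPolynomial.pderiv i G) z)) +
      ((-c) • (evalPoly V F * fun z => conj (evalPoly V (MvPolynomial.X i * G) z)) +
        (-conj c) • (evalPoly V (MvPolynomial.X i) * evalPoly V F *
          fun z => conj (evalPoly V G z)))) 1 = 0 := by
    intro c
    simp only [fock, Pi.one_apply, map_one, mul_one]
    refine mul_eq_zero_of_right _ ?_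
    refine integral_hasLineDerivAt_eq_zero (v := c • b i) (integrable_fock hF hG)
      (integrable_subgaussian_mul ?_) fun z => ?_
    · exact add_mem (add_mem (Subalgebra.smul_mem _ m1 _) (Subalgebra.smul_mem _ m2 _))
        (add_mem (Subalgebra.smul_mem _ m3 _) (Subalgebra.smul_mem _ m4 _))
    · have h1 := hasLineDerivAt_evalPoly F i c z
      have h2 := hasLineDerivAt_evalPoly G i c z
      have h3 := hasLineDerivAt_exp_neg_sq_norm (c • b i) z
      unfold HasLineDerivAt at h1 h2 h3 ⊢
      have h2' := h2.star
      refine ((h1.fun_mul h2').fun_mul h3).congr_deriv ?_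
      have h4 : ((2 * (inner ℂ z (c • b i)).re : ℝ) : ℂ) =
          c * conj (b.repr z i) + conj c * b.repr z i := by
        rw [inner_smul_right, Complex.ofReal_mul, Complex.ofReal_ofNat,
          ← inner_conj_symm z, ← b.repr_apply_apply, Complex.re_eq_add_conj]
        simp
        ring
      have h5 : evalPoly V (MvPolynomial.X i) z = b.repr z i := evalPoly_X i z
      simp only [Pi.add_apply, Pi.smul_apply, Pi.mul_apply, smul_eq_mul, map_mul,
        zero_smul, add_zero, h5, Complex.ofReal_neg, Complex.ofReal_mul] at h4 ⊢
      simp only [Complex.star_def, map_mul, h4]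
      ring
  have key' : ∀ c : ℂ, c * fock (evalPoly V (MvPolynomial.pderiv i F)) (evalPoly V G) +
      conj c * fock (evalPoly V F) (evalPoly V (MvPolynomial.pderiv i G)) +
      (-c * fock (evalPoly V F) (evalPoly V (MvPolynomial.X i * G)) +
      -conj c * fock (evalPoly V (MvPolynomial.X i) * evalPoly V F) (evalPoly V G)) = 0 := by
    intro c
    rw [← key c]
    have h1 := one_mem (subgaussian V)
    rw [fock_add_left (add_mem (Subalgebra.smul_mem _ m1 _) (Subalgebra.smul_mem _ m2 _))
        (add_mem (Subalgebra.smul_mem _ m3 _) (Subalgebra.smul_mem _ m4 _)) h1,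
      fock_add_left (Subalgebra.smul_mem _ m1 _) (Subalgebra.smul_mem _ m2 _) h1,
      fock_add_left (Subalgebra.smul_mem _ m3 _) (Subalgebra.smul_mem _ m4 _) h1]
    simp only [fock_smul_left, fock_mul_conj]
  -- the directions `e_i` and `√-1 e_i` together separate `∂_{z_i}` from `∂_{conj z_i}`
  have k1 := key' 1
  have k2 := key' Complex.I
  rw [map_one] at k1
  rw [Complex.conj_I] at k2
  have k3 : fock (evalPoly V (MvPolynomial.pderiv i F)) (evalPoly V G) -
      fock (evalPoly V F) (evalPoly V (MvPolynomial.pderiv i G)) -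
      fock (evalPoly V F) (evalPoly V (MvPolynomial.X i * G)) +
      fock (evalPoly V (MvPolynomial.X i) * evalPoly V F) (evalPoly V G) = 0 :=
    mul_left_cancel₀ Complex.I_ne_zero (by linear_combination k2)
  linear_combination k1 / 2 + k3 / 2

end Coordinates

/-! ### Fock forms on polynomials -/

section FockForm

open MvPolynomial

/-- Forms on a polynomial algebra that are linear in the first and conjugate-linear in the second
variable. -/
abbrev SesqForm (σ M : Type*) [AddCommGroup M] [Module ℂ M] :=
  MvPolynomial σ ℂ →ₗ[ℂ] MvPolynomial σ ℂ →ₗ⋆[ℂ] M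

/-- The algebraic properties of the Fock inner product: it is Hermitian, the multiplication by a
variable is adjoint to the partial derivative, and `⟨1, 1⟩ = 1`. -/
structure IsFockForm {σ : Type*} (B : SesqForm σ ℂ) : Prop where
  conj_symm : ∀ F G, conj (B F G) = B G F
  pderiv_left : ∀ i F G, B (pderiv i F) G = B F (X i * G)
  one_one : B 1 1 = 1

variable {σ : Type*} {M : Type*} [AddCommGroup M] [Module ℂ M]

theorem IsFockForm.pderiv_right {B : SesqForm σ ℂ} (hB : IsFockForm B) (i : σ)
    (F G : MvPolynomial σ ℂ) : B F (pderiv i G) = B (X i * F) G := by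
  rw [← hB.conj_symm, hB.pderiv_left, hB.conj_symm]

theorem isHomogeneous_zero_iff {F : MvPolynomial σ ℂ} :
    F.IsHomogeneous 0 ↔ ∃ c, F = C c := by
  constructor
  · intro h
    exact ⟨_, totalDegree_eq_zero_iff_eq_C.1 ((totalDegree_zero_iff_isHomogeneous σ).2 h)⟩
  · rintro ⟨c, rfl⟩
    exact isHomogeneous_C σ c

theorem pderiv_eq_zero_of_isHomogeneous_zero {F : MvPolynomial σ ℂ} (h : F.IsHomogeneous 0)
    (i : σ) : pderiv i F = 0 := by
  obtain ⟨c, rfl⟩ := isHomogeneous_zero_iff.1 h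
  exact pderiv_C

theorem pderiv_comm (i j : σ) (F : MvPolynomial σ ℂ) :
    pderiv i (pderiv j F) = pderiv j (pderiv i F) := by
  classical
  have h : ⁅(pderiv i : Derivation ℂ (MvPolynomial σ ℂ) (MvPolynomial σ ℂ)),
      (pderiv j : Derivation ℂ (MvPolynomial σ ℂ) (MvPolynomial σ ℂ))⁆ = 0 := by
    refine derivation_ext fun k => ?_
    rw [Derivation.commutator_apply, pderiv_X, pderiv_X]
    simp only [Pi.single_apply]
    split_ifs <;> simp
  have := congrArg (fun D : Derivation ℂ (MvPolynomial σ ℂ) (MvPolynomial σ ℂ) => D F) h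
  rw [Derivation.commutator_apply, Derivation.zero_apply] at this
  exact sub_eq_zero.1 this

variable [Fintype σ]

/-- The form `(F, G) ↦ ∑ i, φ (∂_i F) (∂_i G)`. When `φ F G` is the function `F * conj G`, this is
the action of the Laplace operator `∑ i, ∂_{z_i} ∂_{conj z_i}`. -/
def contract (φ : SesqForm σ M) : SesqForm σ M :=
  LinearMap.mk₂'ₛₗ (RingHom.id ℂ) (starRingEnd ℂ)
    (fun F G => ∑ i, φ (pderiv i F) (pderiv i G))
    (by simp [Finset.sum_add_distrib])
    (by simp [Finset.smul_sum])
    (by simp [Finset.sum_add_distrib])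
    (by simp [Finset.smul_sum])

/-- The form `(F, G) ↦ ∑ i, φ (X_i F) (X_i G)`. -/
def raise (φ : SesqForm σ M) : SesqForm σ M :=
  LinearMap.mk₂'ₛₗ (RingHom.id ℂ) (starRingEnd ℂ)
    (fun F G => ∑ i, φ (X i * F) (X i * G))
    (by simp [mul_add, Finset.sum_add_distrib])
    (by simp [Finset.smul_sum])
    (by simp [mul_add, Finset.sum_add_distrib])
    (by simp [Finset.smul_sum])

@[simp]
theorem contract_apply (φ : SesqForm σ M) (F G : MvPolynomial σ ℂ) :
    contract φ F G = ∑ i, φ (pderiv i F) (pderiv i G) := rfl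

@[simp]
theorem raise_apply (φ : SesqForm σ M) (F G : MvPolynomial σ ℂ) :
    raise φ F G = ∑ i, φ (X i * F) (X i * G) := rfl

theorem contract_iterate_succ (φ : SesqForm σ M) (k : ℕ) (F G : MvPolynomial σ ℂ) :
    contract^[k + 1] φ F G = ∑ i, contract^[k] φ (pderiv i F) (pderiv i G) := by
  rw [Function.iterate_succ_apply', contract_apply]

theorem raise_iterate_succ (φ : SesqForm σ M) (k : ℕ) (F G : MvPolynomial σ ℂ) :
    raise^[k + 1] φ F G = ∑ i, raise^[k] φ (X i * F) (X i * G) := by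
  rw [Function.iterate_succ_apply', raise_apply]

theorem raise_iterate_sum {ι : Type*} (s : Finset ι) (φ : ι → SesqForm σ M) (k : ℕ)
    (F G : MvPolynomial σ ℂ) :
    raise^[k] (∑ i ∈ s, φ i) F G = ∑ i ∈ s, raise^[k] (φ i) F G := by
  induction k generalizing F G with
  | zero => simp
  | succ k ih =>
    simp only [raise_iterate_succ, ih]
    rw [Finset.sum_comm]

/-- Contractions are compatible with linear maps of the values. -/
theorem contract_iterate_map {N : Type*} [AddCommGroup N] [Module ℂ N] (φ : SesqForm σ M)
    (ψ : SesqForm σ N) (L : M →+ N) (h : ∀ F G, ψ F G = L (φ F G)) (k : ℕ)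
    (F G : MvPolynomial σ ℂ) : contract^[k] ψ F G = L (contract^[k] φ F G) := by
  induction k generalizing F G with
  | zero => exact h F G
  | succ k ih => simp only [contract_iterate_succ, ih, map_sum]

theorem contract_iterate_eq_zero (φ : SesqForm σ M) {k m : ℕ} (hkm : m < k)
    {F G : MvPolynomial σ ℂ} (hG : G.IsHomogeneous m) : contract^[k] φ F G = 0 := by
  induction k generalizing m F G with
  | zero => omega
  | succ k ih =>
    rw [contract_iterate_succ]
    refine Finset.sum_eq_zero fun i _ => ?_
    rcases m with _ | m
    · rw [pderiv_eq_zero_of_isHomogeneous_zero hG, map_zero]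
    · exact ih (by omega) hG.pderiv

theorem sum_X_mul_pderiv {F : MvPolynomial σ ℂ} {m : ℕ} (hF : F.IsHomogeneous m) :
    ∑ i, X i * pderiv i F = m • F := hF.sum_X_mul_pderiv

theorem sum_pderiv_X_mul {F : MvPolynomial σ ℂ} {m : ℕ} (hF : F.IsHomogeneous m) :
    ∑ i, pderiv i (X i * F) = (Fintype.card σ + m) • F := by
  simp only [pderiv_mul, pderiv_X_self, one_mul, Finset.sum_add_distrib, sum_X_mul_pderiv hF,
    Finset.sum_const, Finset.card_univ, add_smul]

variable {B : SesqForm σ ℂ} (hB : IsFockForm B)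
include hB

theorem IsFockForm.sum_pderiv_pderiv {F G : MvPolynomial σ ℂ} {m : ℕ}
    (hG : G.IsHomogeneous m) : ∑ i, B (pderiv i F) (pderiv i G) = m * B F G := by
  simp only [hB.pderiv_left]
  rw [← map_sum, sum_X_mul_pderiv hG, map_nsmul, nsmul_eq_mul]

theorem IsFockForm.sum_X_mul_X_mul {F G : MvPolynomial σ ℂ} {m : ℕ}
    (hG : G.IsHomogeneous m) :
    ∑ i, B (X i * F) (X i * G) = (Fintype.card σ + m : ℕ) * B F G := by
  simp only [← hB.pderiv_right]
  rw [← map_sum, sum_pderiv_X_mul hG, map_nsmul, nsmul_eq_mul]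

omit [Fintype σ] in
theorem IsFockForm.C_C (a b : ℂ) : B (C a) (C b) = a * conj b := by
  have : ∀ c : ℂ, (C c : MvPolynomial σ ℂ) = c • 1 := fun c => by rw [smul_eq_C_mul, mul_one]
  rw [this a, this b]
  simp [hB.one_one, mul_comm]

/-- On homogeneous polynomials of degree `m`, the `m`-th power of the Laplace operator sends
`F * conj G` to the constant `m! ⟨F, G⟩`. -/
theorem IsFockForm.contract_iterate_constantCoeff (φ : SesqForm σ ℂ)
    (hφ : ∀ a b, φ (C a) (C b) = a * conj b) {m : ℕ} {F G : MvPolynomial σ ℂ}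
    (hF : F.IsHomogeneous m) (hG : G.IsHomogeneous m) :
    contract^[m] φ F G = (m.factorial : ℂ) * B F G := by
  induction m generalizing F G with
  | zero =>
    obtain ⟨a, rfl⟩ := isHomogeneous_zero_iff.1 hF
    obtain ⟨b, rfl⟩ := isHomogeneous_zero_iff.1 hG
    simp [hφ, hB.C_C]
  | succ m ih =>
    rw [contract_iterate_succ,
      Finset.sum_congr rfl fun i _ => ih (hF.pderiv (i := i)) (hG.pderiv (i := i)),
      ← Finset.mul_sum, hB.sum_pderiv_pderiv hG, Nat.factorial_succ]
    push_cast
    ring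

end FockForm

/-! ### Orthogonality of complex Hermite polynomials -/

section Hermite

open MvPolynomial

variable {σ : Type*} {B : SesqForm σ ℂ}

/-- The form `(F, G) ↦ ⟨F u, G w⟩`, the Gaussian expectation of `F * conj G * u * conj w`. -/
def mulForm (B : SesqForm σ ℂ) (u w : MvPolynomial σ ℂ) : SesqForm σ ℂ :=
  LinearMap.mk₂'ₛₗ (RingHom.id ℂ) (starRingEnd ℂ) (fun F G => B (F * u) (G * w))
    (by simp [add_mul]) (by simp) (by simp [add_mul]) (by simp)

@[simp]
theorem mulForm_apply (u w F G : MvPolynomial σ ℂ) :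
    mulForm B u w F G = B (F * u) (G * w) := rfl

variable [Fintype σ]

/-- The commutator of a power of the Laplace operator with the multiplication by `conj z_i`. -/
theorem contract_mulForm_X_mul (i : σ) (k : ℕ) (u w F G : MvPolynomial σ ℂ) :
    contract^[k + 1] (mulForm B u w) F (X i * G) =
      contract^[k + 1] (mulForm B u (X i * w)) F G +
        (k + 1) * contract^[k] (mulForm B u w) (pderiv i F) G := by
  classical
  have hX : ∀ (j : σ) (G : MvPolynomial σ ℂ),
      pderiv j (X i * G) = (if j = i then G else 0) + X i * pderiv j G := fun j G => by
    rw [pderiv_mul, pderiv_X]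
    by_cases h : j = i
    · subst h
      simp
    · simp [h, Ne.symm h]
  induction k generalizing F G with
  | zero =>
    simp only [zero_add, contract_iterate_succ, hX, map_add, Finset.sum_add_distrib,
      Function.iterate_zero_apply, apply_ite, map_zero, Finset.sum_ite_eq', Finset.mem_univ,
      if_true, mulForm_apply, Nat.cast_zero, one_mul]
    rw [add_comm]
    congr 1
    refine Finset.sum_congr rfl fun j _ => ?_
    rw [mul_comm (X i), mul_assoc]
  | succ k ih =>
    rw [contract_iterate_succ]
    simp only [hX, map_add, Finset.sum_add_distrib, apply_ite, map_zero, Finset.sum_ite_eq',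
      Finset.mem_univ, if_true]
    have h1 : ∀ j, contract^[k + 1] (mulForm B u w) (pderiv j F) (X i * pderiv j G) =
        contract^[k + 1] (mulForm B u (X i * w)) (pderiv j F) (pderiv j G) +
          (k + 1) * contract^[k] (mulForm B u w) (pderiv j (pderiv i F)) (pderiv j G) := fun j => by
      rw [ih, pderiv_comm i j]
    simp only [h1, Finset.sum_add_distrib, ← Finset.mul_sum]
    rw [← contract_iterate_succ, ← contract_iterate_succ]
    push_cast
    ring

variable (hB : IsFockForm B)
include hB

omit [Fintype σ] in
theorem IsFockForm.mulForm_X_mul_right (i : σ) (u w F G : MvPolynomial σ ℂ) :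
    mulForm B u (X i * w) F G =
      mulForm B u w (pderiv i F) G + mulForm B (pderiv i u) w F G := by
  rw [mulForm_apply, mul_left_comm, ← hB.pderiv_left, pderiv_mul, map_add,
    LinearMap.add_apply]
  rfl

theorem IsFockForm.contract_mulForm_X_mul_right (i : σ) (k : ℕ) (u w F G : MvPolynomial σ ℂ) :
    contract^[k] (mulForm B u (X i * w)) F G =
      contract^[k] (mulForm B u w) (pderiv i F) G +
        contract^[k] (mulForm B (pderiv i u) w) F G := by
  induction k generalizing F G with
  | zero => exact hB.mulForm_X_mul_right i u w F G
  | succ k ih => simp only [contract_iterate_succ, ih, Finset.sum_add_distrib, pderiv_comm i]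

omit hB in
/-- The truncated exponential series `∑ k ≤ m, (-1)^k / k! Δ^k` of the negative Laplace operator,
applied to `F * conj G`. It is the full series if `G` has degree at most `m`. -/
def hermite {M : Type*} [AddCommGroup M] [Module ℂ M] (φ : SesqForm σ M) (m : ℕ)
    (F G : MvPolynomial σ ℂ) : M :=
  ∑ k ∈ Finset.range (m + 1), ((-1) ^ k / (k.factorial : ℂ)) • contract^[k] φ F G

omit hB in
theorem hermite_succ {M : Type*} [AddCommGroup M] [Module ℂ M] (φ : SesqForm σ M) {m : ℕ}
    (F : MvPolynomial σ ℂ) {G : MvPolynomial σ ℂ} (hG : G.IsHomogeneous m) :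
    hermite φ (m + 1) F G = hermite φ m F G := by
  rw [hermite, Finset.sum_range_succ, contract_iterate_eq_zero φ (Nat.lt_succ_self m) hG,
    smul_zero, add_zero]
  rfl

theorem IsFockForm.hermite_X_mul (i : σ) {m : ℕ} (u w F : MvPolynomial σ ℂ)
    {G : MvPolynomial σ ℂ} (hG : G.IsHomogeneous m) :
    hermite (mulForm B u w) (m + 1) F (X i * G) =
      hermite (mulForm B (pderiv i u) w) m F G := by
  have h1 : hermite (mulForm B u w) (m + 1) F (X i * G) =
      hermite (mulForm B u (X i * w)) (m + 1) F G -
        hermite (mulForm B u w) m (pderiv i F) G := by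
    rw [hermite, hermite, hermite, Finset.sum_range_succ', Finset.sum_range_succ' _ (m + 1),
      add_sub_right_comm, ← Finset.sum_sub_distrib]
    congr 1
    · refine Finset.sum_congr rfl fun k _ => ?_
      have hk : (k.factorial : ℂ) ≠ 0 := by exact_mod_cast k.factorial_ne_zero
      have hk1 : (k : ℂ) + 1 ≠ 0 := by exact_mod_cast k.succ_ne_zero
      rw [contract_mulForm_X_mul, Nat.factorial_succ]
      simp only [smul_eq_mul]
      push_cast
      field_simp
      ring
    · simp only [Function.iterate_zero_apply, mulForm_apply]
      rw [mul_comm (X i), mul_assoc]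
  rw [h1, hermite_succ _ _ hG, hermite, hermite, hermite, ← Finset.sum_sub_distrib]
  refine Finset.sum_congr rfl fun k _ => ?_
  rw [hB.contract_mulForm_X_mul_right, smul_add, add_sub_cancel_left]

/-- Integrating `exp(-Δ)(F * conj G)` against `u * conj w` gives `⟨u, G⟩ ⟨F, w⟩`, if the degree of
`u` does not exceed the degree of `G`. In general the result is the matrix coefficient of the
normally ordered differential operator `F(z) G(∂)`, in which `u` is first differentiated. -/
theorem IsFockForm.hermite_eq (F w : MvPolynomial σ ℂ) {m l : ℕ} (hlm : l ≤ m)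
    {G u : MvPolynomial σ ℂ} (hG : G.IsHomogeneous m) (hu : u.IsHomogeneous l) :
    hermite (mulForm B u w) m F G = B u G * B F w := by
  induction m generalizing G u l with
  | zero =>
    obtain rfl : l = 0 := Nat.le_zero.1 hlm
    obtain ⟨a, rfl⟩ := isHomogeneous_zero_iff.1 hG
    obtain ⟨b, rfl⟩ := isHomogeneous_zero_iff.1 hu
    have h1 : F * C b = b • F := by rw [mul_comm, C_mul']
    simp only [hermite, zero_add, Finset.range_one, Finset.sum_singleton, pow_zero,
      Nat.factorial_zero, Nat.cast_one, div_one, Function.iterate_zero_apply,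
      mulForm_apply, h1, C_mul', hB.C_C, map_smul, map_smulₛₗ, LinearMap.smul_apply, smul_eq_mul]
    ring
  | succ m ih =>
    have hi : ∀ i, hermite (mulForm B u w) (m + 1) F (X i * pderiv i G) =
        B u (X i * pderiv i G) * B F w := fun i => by
      have hG' : (pderiv i G).IsHomogeneous m := hG.pderiv
      rw [hB.hermite_X_mul i u w F hG', ← hB.pderiv_left]
      rcases l with _ | l
      · rw [pderiv_eq_zero_of_isHomogeneous_zero hu, map_zero, LinearMap.zero_apply, zero_mul]
        have h0 : ∀ k, ∀ F G, contract^[k] (mulForm B 0 w) F G = 0 := fun k => by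
          induction k with
          | zero => simp
          | succ k ihk =>
            intro F G
            rw [contract_iterate_succ]
            simp [ihk]
        simp [hermite, h0]
      · exact ih (by omega) hG' hu.pderiv
    have hsum := Finset.sum_congr rfl fun i (_ : i ∈ Finset.univ) => hi i
    rw [← Finset.sum_mul, ← map_sum, sum_X_mul_pderiv hG] at hsum
    have h2 : ∑ i, hermite (mulForm B u w) (m + 1) F (X i * pderiv i G) =
        ((m + 1 : ℕ) : ℂ) * hermite (mulForm B u w) (m + 1) F G := by
      simp only [hermite]
      rw [Finset.sum_comm, Finset.mul_sum]
      refine Finset.sum_congr rfl fun k _ => ?_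
      rw [← Finset.smul_sum, ← map_sum, sum_X_mul_pderiv hG, map_nsmul, nsmul_eq_mul,
        smul_eq_mul, smul_eq_mul]
      ring
    rw [h2, map_nsmul, nsmul_eq_mul, mul_assoc] at hsum
    exact mul_left_cancel₀ (by exact_mod_cast m.succ_ne_zero) hsum

end Hermite

/-! ### Multiplicity-free orthonormal systems of polynomials -/

section System

open MvPolynomial

variable {σ : Type*} {B : SesqForm σ ℂ}

/-- The form `(F, G) ↦ ⟨F, g⟩ ⟨f, G⟩` of the operator of rank one attached to `f` and `g`. -/
def rankOneForm (B : SesqForm σ ℂ) (f g : MvPolynomial σ ℂ) : SesqForm σ ℂ :=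
  LinearMap.mk₂'ₛₗ (RingHom.id ℂ) (starRingEnd ℂ) (fun F G => B F g * B f G)
    (by simp [add_mul]) (by simp [mul_assoc]) (by simp [mul_add]) (by simp [mul_left_comm])

@[simp]
theorem rankOneForm_apply (f g F G : MvPolynomial σ ℂ) :
    rankOneForm B f g F G = B F g * B f G := rfl

/-- The form `(F, G) ↦ ⟨π F, G⟩`, where `π` is the orthogonal projection onto the span of the
orthonormal family `v`. -/
def projForm {ι : Type*} [Fintype ι] (B : SesqForm σ ℂ) (v : ι → MvPolynomial σ ℂ) :
    SesqForm σ ℂ :=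
  ∑ j, rankOneForm B (v j) (v j)

theorem projForm_apply {ι : Type*} [Fintype ι] (v : ι → MvPolynomial σ ℂ)
    (F G : MvPolynomial σ ℂ) : projForm B v F G = ∑ j, B F (v j) * B (v j) G := by
  simp [projForm, LinearMap.sum_apply]

variable [Fintype σ] {Λ : Type*} {ι : Λ → Type*} [∀ a, Fintype (ι a)] [∀ a, DecidableEq (ι a)]

/-- A decomposition of the polynomials into finite-dimensional homogeneous subspaces with
orthonormal bases `u a`, such that Schur's lemma holds for the forms `(F, G) ↦ ∑ ⟨π F', G'⟩`, where
`π` is the orthogonal projection onto one of the subspaces and `F'`, `G'` run through the multiples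
of `F`, `G` by the same word of a given length in the variables. -/
structure IsMultFreeSystem (B : SesqForm σ ℂ) (deg : Λ → ℕ)
    (u : ∀ a, ι a → MvPolynomial σ ℂ) : Prop where
  form : IsFockForm B
  nonempty : ∀ a, Nonempty (ι a)
  homogeneous : ∀ a i, (u a i).IsHomogeneous (deg a)
  orthonormal : ∀ a i j, B (u a i) (u a j) = if i = j then 1 else 0
  orthogonal : ∀ a b, a ≠ b → ∀ i j, B (u a i) (u b j) = 0
  span_eq : Submodule.span ℂ (Set.range fun s : Σ a, ι a => u s.1 s.2) = ⊤
  finite_level : ∀ m, {a | deg a = m}.Finite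
  schur_ne : ∀ a k b c, b ≠ c → ∀ i j, raise^[k] (projForm B (u a)) (u b i) (u c j) = 0
  schur_self : ∀ a k b, ∃ x : ℂ, ∀ i j,
    raise^[k] (projForm B (u a)) (u b i) (u b j) = if i = j then x else 0

variable {deg : Λ → ℕ} {u : ∀ a, ι a → MvPolynomial σ ℂ}

/-- The trace of the form `raise^[k] (projForm B (u a))` on the span of `u b`. -/
def traceCoeff (B : SesqForm σ ℂ) (u : ∀ a, ι a → MvPolynomial σ ℂ) (a : Λ) (k : ℕ) (b : Λ) : ℂ :=
  ∑ i, raise^[k] (projForm B (u a)) (u b i) (u b i)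

/-- The sum of the squares of the matrix coefficients `⟨z_l u_b, u_a⟩`. For
`deg a = deg b + 1`, the generalized binomial coefficient `[a, b]` is this weight divided by the
dimension of the span of `u a`. -/
def neighbourWeight (B : SesqForm σ ℂ) (u : ∀ a, ι a → MvPolynomial σ ℂ) (a b : Λ) : ℝ :=
  ∑ i, ∑ l, ∑ j, Complex.normSq (B (X l * u b i) (u a j))

omit [∀ a, DecidableEq (ι a)] in
theorem neighbourWeight_nonneg (a b : Λ) : 0 ≤ neighbourWeight B u a b :=
  Finset.sum_nonneg fun _ _ => Finset.sum_nonneg fun _ _ => Finset.sum_nonneg fun _ _ =>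
    Complex.normSq_nonneg _

/-- The average of `φ F F` over the orthonormal basis `u a`. When `φ F G` is the function
`F * conj G`, this is the invariant polynomial `p_a`. -/
def average {M : Type*} [AddCommGroup M] [Module ℂ M] (φ : SesqForm σ M)
    (u : ∀ a, ι a → MvPolynomial σ ℂ) (a : Λ) : M :=
  (1 / (Fintype.card (ι a) : ℂ)) • ∑ j, φ (u a j) (u a j)

/-- The result of applying `exp(-Δ)` to `average φ u a`, where `Δ` is the Laplace operator. -/
def hermiteAverage {M : Type*} [AddCommGroup M] [Module ℂ M] (φ : SesqForm σ M) (deg : Λ → ℕ)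
    (u : ∀ a, ι a → MvPolynomial σ ℂ) (a : Λ) : M :=
  (1 / (Fintype.card (ι a) : ℂ)) • ∑ j, hermite φ (deg a) (u a j) (u a j)

namespace IsMultFreeSystem

variable (h : IsMultFreeSystem B deg u)
include h

theorem card_ne_zero (a : Λ) : (Fintype.card (ι a) : ℂ) ≠ 0 := by
  have := h.nonempty a
  exact_mod_cast Fintype.card_ne_zero

theorem traceCoeff_one (a b : Λ) : traceCoeff B u a 1 b = neighbourWeight B u a b := by
  simp only [traceCoeff, neighbourWeight, Function.iterate_one, raise_apply, projForm_apply,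
    Complex.ofReal_sum, Complex.normSq_eq_conj_mul_self, h.form.conj_symm]
  simp only [mul_comm]

/-- The members of the system of degree `r`. -/
def basisOf (r : ℕ) : Finset (Σ a, ι a) := (h.finite_level r).toFinset.sigma fun _ => Finset.univ

theorem homogeneousComponent_eq (r : ℕ) (F : MvPolynomial σ ℂ) :
    homogeneousComponent r F =
      ∑ a ∈ (h.finite_level r).toFinset, ∑ i, B F (u a i) • u a i := by
  classical
  have hF : F ∈ Submodule.span ℂ (Set.range fun s : Σ a, ι a => u s.1 s.2) := by
    rw [h.span_eq]
    trivial
  induction hF using Submodule.span_induction with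
  | mem F hF =>
    obtain ⟨⟨b, j⟩, rfl⟩ := hF
    have h1 : ∀ a, ∑ i, B (u b j) (u a i) • u a i = if a = b then u b j else 0 := fun a => by
      split_ifs with hab
      · subst hab
        simp [h.orthonormal]
      · simp [h.orthogonal b a (Ne.symm hab)]
    simp only [h1, Finset.sum_ite_eq', Set.Finite.mem_toFinset, Set.mem_ofPred_eq]
    rw [homogeneousComponent_of_mem ((mem_homogeneousSubmodule _ _).2 (h.homogeneous b j))]
    simp only [eq_comm]
  | zero => simp
  | add F G _ _ hF hG => simp [hF, hG, add_smul, Finset.sum_add_distrib]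
  | smul c F _ hF => simp [hF, Finset.smul_sum, mul_smul]

theorem expand {r : ℕ} {F : MvPolynomial σ ℂ} (hF : F.IsHomogeneous r) :
    F = ∑ a ∈ (h.finite_level r).toFinset, ∑ i, B F (u a i) • u a i := by
  rw [← h.homogeneousComponent_eq, homogeneousComponent_of_mem
    ((mem_homogeneousSubmodule _ _).2 hF), if_pos rfl]

theorem parseval {r : ℕ} {F : MvPolynomial σ ℂ} (hF : F.IsHomogeneous r) (G : MvPolynomial σ ℂ) :
    B F G = ∑ a ∈ (h.finite_level r).toFinset, ∑ i, B F (u a i) * B (u a i) G := by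
  conv_lhs => rw [h.expand hF]
  simp [LinearMap.sum_apply]

theorem map_expand {M : Type*} [AddCommGroup M] [Module ℂ M] (φ : SesqForm σ M) {r : ℕ}
    {F G : MvPolynomial σ ℂ} (hF : F.IsHomogeneous r) (hG : G.IsHomogeneous r) :
    φ F G = ∑ s ∈ h.basisOf r, ∑ t ∈ h.basisOf r,
      (B (u t.1 t.2) G * B F (u s.1 s.2)) • φ (u s.1 s.2) (u t.1 t.2) := by
  have hF' : F = ∑ s ∈ h.basisOf r, B F (u s.1 s.2) • u s.1 s.2 := by
    rw [basisOf, Finset.sum_sigma]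
    exact h.expand hF
  have hG' : G = ∑ s ∈ h.basisOf r, B G (u s.1 s.2) • u s.1 s.2 := by
    rw [basisOf, Finset.sum_sigma]
    exact h.expand hG
  conv_lhs => rw [hF', hG']
  simp only [map_sum, LinearMap.sum_apply, map_smul, map_smulₛₗ, LinearMap.smul_apply,
    h.form.conj_symm, smul_smul, Finset.smul_sum]
  rw [Finset.sum_comm]

/-- The powers of the Laplace operator in terms of the orthonormal basis. The matrix coefficients
are those of `raise`, because `contract` and `raise` are adjoint to each other. -/
theorem contract_iterate_expand {M : Type*} [AddCommGroup M] [Module ℂ M] (φ : SesqForm σ M)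
    {r k : ℕ} {F G : MvPolynomial σ ℂ} (hF : F.IsHomogeneous (r + k))
    (hG : G.IsHomogeneous (r + k)) :
    contract^[k] φ F G = ∑ s ∈ h.basisOf r, ∑ t ∈ h.basisOf r,
      raise^[k] (rankOneForm B F G) (u t.1 t.2) (u s.1 s.2) • φ (u s.1 s.2) (u t.1 t.2) := by
  induction k generalizing F G with
  | zero => exact h.map_expand φ hF hG
  | succ k ih =>
    have h1 : raise (rankOneForm B F G) = ∑ i, rankOneForm B (pderiv i F) (pderiv i G) := by
      refine LinearMap.ext fun P => LinearMap.ext fun Q => ?_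
      simp [LinearMap.sum_apply, h.form.pderiv_left, h.form.pderiv_right]
    rw [contract_iterate_succ, Finset.sum_congr rfl fun i _ =>
      ih (hF.pderiv (i := i)) (hG.pderiv (i := i)), Finset.sum_comm]
    refine Finset.sum_congr rfl fun s _ => ?_
    rw [Finset.sum_comm]
    refine Finset.sum_congr rfl fun t _ => ?_
    rw [Function.iterate_succ_apply, h1, raise_iterate_sum, Finset.sum_smul]

theorem sum_eq_card_smul_average {M : Type*} [AddCommGroup M] [Module ℂ M] (φ : SesqForm σ M)
    (b : Λ) : ∑ i, φ (u b i) (u b i) = (Fintype.card (ι b) : ℂ) • average φ u b := by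
  rw [average, smul_smul, mul_one_div_cancel (h.card_ne_zero b), one_smul]

/-- By Schur's lemma the powers of the Laplace operator map averages to linear combinations of
averages. -/
theorem sum_contract_iterate {M : Type*} [AddCommGroup M] [Module ℂ M] (φ : SesqForm σ M)
    {r k : ℕ} {a : Λ} (ha : deg a = r + k) :
    ∑ j, contract^[k] φ (u a j) (u a j) =
      ∑ b ∈ (h.finite_level r).toFinset, traceCoeff B u a k b • average φ u b := by
  have hj : ∀ j, (u a j).IsHomogeneous (r + k) := fun j => ha ▸ h.homogeneous a j
  rw [Finset.sum_congr rfl fun j _ => h.contract_iterate_expand φ (hj j) (hj j), Finset.sum_comm]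
  have h1 : ∀ s ∈ h.basisOf r, ∑ j, ∑ t ∈ h.basisOf r,
      raise^[k] (rankOneForm B (u a j) (u a j)) (u t.1 t.2) (u s.1 s.2) •
        φ (u s.1 s.2) (u t.1 t.2) =
      raise^[k] (projForm B (u a)) (u s.1 s.2) (u s.1 s.2) • φ (u s.1 s.2) (u s.1 s.2) := by
    intro s hs
    rw [Finset.sum_comm]
    simp only [← Finset.sum_smul, ← raise_iterate_sum]
    refine Finset.sum_eq_single s (fun t _ hts => ?_) (fun h => absurd hs h)
    obtain ⟨b, i⟩ := s
    obtain ⟨c, j⟩ := t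
    suffices h0 : raise^[k] (projForm B (u a)) (u c j) (u b i) = 0 by
      rw [← projForm, h0, zero_smul]
    by_cases hcb : c = b
    · subst hcb
      obtain ⟨x, hx⟩ := h.schur_self a k c
      rw [hx, if_neg]
      rintro rfl
      exact hts rfl
    · exact h.schur_ne a k c b hcb j i
  rw [Finset.sum_congr rfl h1, basisOf, Finset.sum_sigma]
  refine Finset.sum_congr rfl fun b _ => ?_
  obtain ⟨x, hx⟩ := h.schur_self a k b
  simp only [traceCoeff, hx, if_true]
  rw [← Finset.smul_sum, h.sum_eq_card_smul_average, smul_smul, Finset.sum_const, Finset.card_univ,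
    nsmul_eq_mul, mul_comm]

/-- `exp(-Δ) p_a` is `p_a` plus a linear combination of the `p_b` of lower degree. -/
theorem exists_hermiteAverage_eq {M : Type*} [AddCommGroup M] [Module ℂ M] (φ : SesqForm σ M)
    (a : Λ) : ∃ x : Λ →₀ ℂ, hermiteAverage φ deg u a =
        Finsupp.linearCombination ℂ (average φ u) x ∧ x a = 1 ∧
      (∀ b, deg a ≤ deg b → b ≠ a → x b = 0) ∧
      ∀ b, deg a = deg b + 1 → x b = -(neighbourWeight B u a b / Fintype.card (ι a) : ℂ) := by
  classical
  -- `w k b` is the coefficient of `p_b` in the term of order `k + 1` of the exponential series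
  let w : ℕ → Λ → ℂ := fun k b =>
    1 / (Fintype.card (ι a) : ℂ) * ((-1) ^ (k + 1) / ((k + 1).factorial : ℂ)) *
      traceCoeff B u a (k + 1) b
  let y : Λ →₀ ℂ := ∑ k ∈ Finset.range (deg a),
    ∑ b ∈ (h.finite_level (deg a - (k + 1))).toFinset, Finsupp.single b (w k b)
  have hy : ∀ b, y b = if deg b < deg a then w (deg a - (deg b + 1)) b else 0 := by
    intro b
    simp only [y, Finsupp.finsetSum_apply, Finsupp.single_apply, Finset.sum_ite_eq',
      Set.Finite.mem_toFinset, Set.mem_ofPred_eq]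
    split_ifs with hb
    · rw [Finset.sum_eq_single (deg a - (deg b + 1)), if_pos (by omega)]
      · intro k hk hne
        rw [Finset.mem_range] at hk
        exact if_neg (by omega)
      · intro hk
        rw [Finset.mem_range] at hk
        omega
    · refine Finset.sum_eq_zero fun k hk => ?_
      rw [Finset.mem_range] at hk
      exact if_neg (by omega)
  refine ⟨Finsupp.single a 1 + y, ?_, ?_, ?_, ?_⟩
  · rw [map_add, Finsupp.linearCombination_single, one_smul, hermiteAverage]
    simp only [hermite]
    rw [Finset.sum_comm, Finset.sum_range_succ', add_comm, smul_add]
    congr 1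
    · simp [average]
    · simp only [y, map_sum, Finsupp.linearCombination_single]
      rw [Finset.smul_sum]
      refine Finset.sum_congr rfl fun k hk => ?_
      rw [Finset.mem_range] at hk
      rw [← Finset.smul_sum, h.sum_contract_iterate φ (r := deg a - (k + 1)) (by omega),
        smul_smul, Finset.smul_sum]
      simp only [smul_smul, w]
  · simp [hy]
  · intro b hb hne
    simp [hy, hb.not_gt, Ne.symm hne]
  · intro b hb
    have hne : a ≠ b := by
      rintro rfl
      omega
    rw [Finsupp.add_apply, hy, if_pos (by omega), Finsupp.single_apply, if_neg hne, zero_add,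
      show deg a - (deg b + 1) = 0 by omega]
    simp only [w, zero_add, h.traceCoeff_one]
    simp
    ring

/-- The trace of `∑ l, ∂_l z_l` on the span of `u b`. -/
theorem sum_neighbourWeight_left {b : Λ} :
    ∑ a ∈ (h.finite_level (deg b + 1)).toFinset, neighbourWeight B u a b =
      Fintype.card (ι b) * (Fintype.card σ + deg b : ℝ) := by
  have h1 : ∀ i, ∑ a ∈ (h.finite_level (deg b + 1)).toFinset, ∑ l, ∑ j,
      (Complex.normSq (B (X l * u b i) (u a j)) : ℂ) = (Fintype.card σ + deg b : ℕ) := fun i => by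
    rw [Finset.sum_comm]
    have h2 : ∀ l, (X l * u b i).IsHomogeneous (deg b + 1) := fun l => by
      rw [add_comm]
      exact (isHomogeneous_X ℂ l).mul (h.homogeneous b i)
    have h3 := h.form.sum_X_mul_X_mul (F := u b i) (h.homogeneous b i)
    rw [h.orthonormal, if_pos rfl, mul_one] at h3
    rw [← h3]
    refine Finset.sum_congr rfl fun l _ => ?_
    rw [h.parseval (h2 l)]
    simp only [← Complex.mul_conj, h.form.conj_symm]
  have h4 : ((∑ a ∈ (h.finite_level (deg b + 1)).toFinset, neighbourWeight B u a b : ℝ) : ℂ) =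
      ((Fintype.card (ι b) * (Fintype.card σ + deg b : ℝ) : ℝ) : ℂ) := by
    simp only [neighbourWeight, Complex.ofReal_sum]
    rw [Finset.sum_comm, Finset.sum_congr rfl fun i _ => h1 i]
    simp [mul_add]
  exact_mod_cast h4

/-- The trace of `∑ l, z_l ∂_l` on the span of `u a`. -/
theorem sum_neighbourWeight_right {a : Λ} {m : ℕ} (ha : deg a = m + 1) :
    ∑ b ∈ (h.finite_level m).toFinset, neighbourWeight B u a b =
      Fintype.card (ι a) * (deg a : ℝ) := by
  have h1 : ∀ j, ∑ l, ∑ b ∈ (h.finite_level m).toFinset, ∑ i,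
      (Complex.normSq (B (X l * u b i) (u a j)) : ℂ) = deg a := fun j => by
    have h2 : ∀ l, (pderiv l (u a j)).IsHomogeneous m := fun l => by
      have := (h.homogeneous a j).pderiv (i := l)
      rwa [ha, Nat.add_sub_cancel] at this
    have h3 := h.form.sum_pderiv_pderiv (F := u a j) (h.homogeneous a j)
    rw [h.orthonormal, if_pos rfl, mul_one] at h3
    rw [← h3]
    refine Finset.sum_congr rfl fun l _ => ?_
    rw [h.parseval (h2 l)]
    simp only [← Complex.mul_conj, h.form.conj_symm, ← h.form.pderiv_right]
    simp only [mul_comm]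
  have h4 : ((∑ b ∈ (h.finite_level m).toFinset, neighbourWeight B u a b : ℝ) : ℂ) =
      ((Fintype.card (ι a) * (deg a : ℝ) : ℝ) : ℂ) := by
    simp only [neighbourWeight, Complex.ofReal_sum]
    have h5 : ∀ b, ∑ i, ∑ l, ∑ j, (Complex.normSq (B (X l * u b i) (u a j)) : ℂ) =
        ∑ j, ∑ l, ∑ i, (Complex.normSq (B (X l * u b i) (u a j)) : ℂ) := fun b => by
      rw [Finset.sum_comm]
      rw [Finset.sum_congr rfl fun l _ => Finset.sum_comm, Finset.sum_comm]
    simp only [h5]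
    rw [Finset.sum_comm, Finset.sum_congr rfl fun j _ => (Finset.sum_comm).trans (h1 j)]
    simp
  exact_mod_cast h4

/-- The value of `exp(-Δ) p_a` at `0`: only the term of order `deg a` of the exponential series
contributes. -/
theorem hermiteAverage_constantCoeff (φ : SesqForm σ ℂ)
    (hφ : ∀ F G, φ F G = constantCoeff F * conj (constantCoeff G)) (a : Λ) :
    hermiteAverage φ deg u a = (-1) ^ deg a := by
  have h0 : ∀ k m, k < m → ∀ F G : MvPolynomial σ ℂ, F.IsHomogeneous m →
      contract^[k] φ F G = 0 := by
    intro k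
    induction k with
    | zero =>
      intro m hm F G hF
      rw [Function.iterate_zero_apply, hφ, constantCoeff_eq,
        hF.coeff_eq_zero (by simpa using hm.ne), zero_mul]
    | succ k ih =>
      intro m hm F G hF
      rw [contract_iterate_succ]
      exact Finset.sum_eq_zero fun i _ => ih (m - 1) (by omega) _ _ hF.pderiv
  have h1 : ∀ j, hermite φ (deg a) (u a j) (u a j) = (-1) ^ deg a := fun j => by
    have hj := h.homogeneous a j
    rw [hermite, Finset.sum_range_succ, h.form.contract_iterate_constantCoeff φ
      (fun a b => by simp [hφ]) hj hj, h.orthonormal, if_pos rfl, Finset.sum_eq_zero]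
    · have : ((deg a).factorial : ℂ) ≠ 0 := by exact_mod_cast (deg a).factorial_ne_zero
      simp [this]
    · intro k hk
      rw [h0 k (deg a) (Finset.mem_range.1 hk) _ _ hj, smul_zero]
  rw [hermiteAverage, Finset.sum_congr rfl fun j _ => h1 j, Finset.sum_const, Finset.card_univ,
    ← Nat.cast_smul_eq_nsmul ℂ, smul_smul, one_div_mul_cancel (h.card_ne_zero a), one_smul]

/-- The pairing of `exp(-Δ) (∑ j, |u a j|²)` with `|u b i|²`. -/
theorem sum_hermite_mulForm {a b : Λ} (hab : deg b ≤ deg a) (i : ι b) [Decidable (a = b)] :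
    ∑ j, hermite (mulForm B (u b i) (u b i)) (deg a) (u a j) (u a j) =
      if a = b then 1 else 0 := by
  simp only [h.form.hermite_eq _ _ hab (h.homogeneous a _) (h.homogeneous b i)]
  split_ifs with heq
  · subst heq
    simp [h.orthonormal]
  · simp [h.orthogonal a b heq]

end IsMultFreeSystem

end System

/-! ### Substitutions and invariant forms -/

section Substitution

open MvPolynomial

variable {V : Type*} [NormedAddCommGroup V] [InnerProductSpace ℂ V] [FiniteDimensional ℂ V]

/-- Substitution of a unitary operator into a polynomial. -/
def subst (k : V ≃ₗᵢ[ℂ] V) : MvPolynomial (Fin (Module.finrank ℂ V)) ℂ →ₐ[ℂ]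
    MvPolynomial (Fin (Module.finrank ℂ V)) ℂ :=
  aeval fun i => ∑ j, C ((stdOrthonormalBasis ℂ V).repr (k (stdOrthonormalBasis ℂ V j)) i) * X j

theorem evalPoly_subst (k : V ≃ₗᵢ[ℂ] V) (F : MvPolynomial (Fin (Module.finrank ℂ V)) ℂ) :
    evalPoly V (subst k F) = evalPoly V F ∘ k := by
  induction F using MvPolynomial.induction_on with
  | C a =>
    ext z
    simp [subst, evalPoly_apply]
  | add p q hp hq => rw [map_add, map_add, map_add, hp, hq]; rfl
  | mul_X p i hp =>
    rw [map_mul, map_mul, map_mul, hp]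
    ext z
    rw [Pi.mul_apply, Function.comp_apply, Function.comp_apply, Pi.mul_apply, evalPoly_X]
    congr 1
    conv_rhs => rw [← (stdOrthonormalBasis ℂ V).sum_repr z, map_sum, map_sum]
    rw [subst, aeval_X, evalPoly_apply]
    simp [mul_comm]

/-- The substitution `z ↦ c z`. -/
def scale {σ : Type*} (c : ℂ) : MvPolynomial σ ℂ →ₐ[ℂ] MvPolynomial σ ℂ :=
  aeval fun i => C c * X i

theorem coeff_scale {σ : Type*} (c : ℂ) (F : MvPolynomial σ ℂ) (s : σ →₀ ℕ) :
    coeff s (scale c F) = c ^ s.degree * coeff s F := by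
  classical
  induction F using MvPolynomial.induction_on' with
  | monomial t a =>
    have h : scale c (monomial t a) = C (c ^ t.degree) * monomial t a := by
      rw [scale, aeval_monomial, monomial_eq (s := t) (a := a), algebraMap_eq]
      simp only [mul_pow, Finsupp.prod, Finset.prod_mul_distrib, ← C_pow]
      rw [← map_prod, Finset.prod_pow_eq_pow_sum, Finsupp.degree_apply]
      ring
    rw [h, coeff_C_mul, coeff_monomial]
    split_ifs with hts
    · rw [hts]
    · simp
  | add p q hp hq => rw [map_add, coeff_add, coeff_add, hp, hq, mul_add]

theorem scale_eq_of_isHomogeneous {σ : Type*} (c : ℂ) {F : MvPolynomial σ ℂ} {m : ℕ}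
    (hF : F.IsHomogeneous m) : scale c F = c ^ m • F := by
  ext s
  rw [coeff_scale, coeff_smul, smul_eq_mul]
  by_cases hs : s.degree = m
  · rw [hs]
  · rw [hF.coeff_eq_zero hs, mul_zero, mul_zero]

theorem evalPoly_scale (c : ℂ) (F : MvPolynomial (Fin (Module.finrank ℂ V)) ℂ) (z : V) :
    evalPoly V (scale c F) z = evalPoly V F (c • z) := by
  induction F using MvPolynomial.induction_on with
  | C a => simp [scale, evalPoly_apply]
  | add p q hp hq => simp only [map_add, Pi.add_apply, hp, hq]
  | mul_X p i hp =>
    rw [map_mul, map_mul, map_mul, Pi.mul_apply, Pi.mul_apply, hp]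
    simp [scale, evalPoly_apply]

theorem scale_subst (c : ℂ) (k : V ≃ₗᵢ[ℂ] V) (F : MvPolynomial (Fin (Module.finrank ℂ V)) ℂ) :
    scale c (subst k F) = subst k (scale c F) := by
  apply evalPoly_injective (V := V)
  ext z
  rw [evalPoly_scale, evalPoly_subst, evalPoly_subst, Function.comp_apply, Function.comp_apply,
    evalPoly_scale, map_smul]

/-- Invariance of a form under the substitutions from a group of unitary operators. -/
def IsInvariantForm (K : Subgroup (V ≃ₗᵢ[ℂ] V))
    (S : SesqForm (Fin (Module.finrank ℂ V)) ℂ) : Prop :=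
  ∀ k ∈ K, ∀ F G, S (subst k F) (subst k G) = S F G

/-- The sum over the coordinates in `raise` is invariant because the matrix of a unitary operator is
unitary. -/
theorem isInvariantForm_raise {K : Subgroup (V ≃ₗᵢ[ℂ] V)}
    {S : SesqForm (Fin (Module.finrank ℂ V)) ℂ} (hS : IsInvariantForm K S) :
    IsInvariantForm K (raise S) := by
  intro k hk F G
  set b := stdOrthonormalBasis ℂ V with hb
  have hU : ∀ j j', ∑ i, b.repr (k (b j)) i * conj (b.repr (k (b j')) i) =
      if j = j' then 1 else 0 := fun j j' => by
    have h1 := b.sum_inner_mul_inner (k (b j')) (k (b j))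
    rw [k.inner_map_map, orthonormal_iff_ite.1 b.orthonormal] at h1
    simp only [b.repr_apply_apply, inner_conj_symm]
    rw [← ite_congr (propext eq_comm) (fun _ => rfl) (fun _ => rfl), ← h1]
    simp only [mul_comm]
  have hX : ∀ i, subst k (X i) = ∑ j, b.repr (k (b j)) i • X j := fun i => by
    simp only [subst, aeval_X, smul_eq_C_mul, ← hb]
  have h1 : ∀ i, S (X i * F) (X i * G) = ∑ j, ∑ j',
      (b.repr (k (b j)) i * conj (b.repr (k (b j')) i)) •
        S (X j * subst k F) (X j' * subst k G) := fun i => by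
    rw [← hS k hk, map_mul (subst k), map_mul (subst k), hX, Finset.sum_mul, Finset.sum_mul]
    simp only [map_sum, LinearMap.sum_apply, smul_mul_assoc, map_smul, map_smulₛₗ,
      LinearMap.smul_apply, smul_smul, Finset.smul_sum]
    rw [Finset.sum_comm]
    exact Finset.sum_congr rfl fun j _ => Finset.sum_congr rfl fun j' _ => by
      rw [mul_comm (conj _)]
  simp only [raise_apply, h1]
  rw [Finset.sum_comm]
  refine Finset.sum_congr rfl fun j _ => ?_
  rw [Finset.sum_comm]
  simp only [← Finset.sum_smul, hU, ite_smul, one_smul, zero_smul, Finset.sum_ite_eq,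
    Finset.mem_univ, if_true]

theorem isInvariantForm_raise_iterate {K : Subgroup (V ≃ₗᵢ[ℂ] V)}
    {S : SesqForm (Fin (Module.finrank ℂ V)) ℂ} (hS : IsInvariantForm K S) (m : ℕ) :
    IsInvariantForm K (raise^[m] S) := by
  induction m with
  | zero => exact hS
  | succ m ih =>
    rw [Function.iterate_succ_apply']
    exact isInvariantForm_raise ih

/-- Composing the first variable with the scaling `z ↦ c z` preserves invariance. -/
theorem isInvariantForm_scale {K : Subgroup (V ≃ₗᵢ[ℂ] V)}
    {S : SesqForm (Fin (Module.finrank ℂ V)) ℂ} (hS : IsInvariantForm K S) (c : ℂ) :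
    IsInvariantForm K (S.comp (scale c).toLinearMap) := by
  intro k hk F G
  simp only [LinearMap.comp_apply, AlgHom.toLinearMap_apply]
  rw [scale_subst, hS k hk]

variable [MeasurableSpace V] [BorelSpace V]

/-- The Fock inner product as a form on polynomials. -/
def fockForm (V : Type*) [NormedAddCommGroup V] [InnerProductSpace ℂ V] [FiniteDimensional ℂ V]
    [MeasurableSpace V] [BorelSpace V] : SesqForm (Fin (Module.finrank ℂ V)) ℂ :=
  LinearMap.mk₂'ₛₗ (RingHom.id ℂ) (starRingEnd ℂ)
    (fun F G => fock (evalPoly V F) (evalPoly V G))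
    (fun F₁ F₂ G => by
      rw [map_add, fock_add_left] <;> exact evalPoly_mem_subgaussian _)
    (fun c F G => by rw [map_smul, fock_smul_left]; rfl)
    (fun F G₁ G₂ => by
      rw [map_add, fock_add_right] <;> exact evalPoly_mem_subgaussian _)
    (fun c F G => by rw [map_smul, fock_smul_right]; rfl)

@[simp]
theorem fockForm_apply (F G : MvPolynomial (Fin (Module.finrank ℂ V)) ℂ) :
    fockForm V F G = fock (evalPoly V F) (evalPoly V G) := rfl

theorem isFockForm_fockForm : IsFockForm (fockForm V) where
  conj_symm _ _ := fock_conj_symm _ _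
  pderiv_left i F G := fock_pderiv F G i
  one_one := by rw [fockForm_apply, map_one, fock_one_one]

theorem isInvariantForm_fockForm (K : Subgroup (V ≃ₗᵢ[ℂ] V)) : IsInvariantForm K (fockForm V) := by
  intro k _ F G
  rw [fockForm_apply, evalPoly_subst, evalPoly_subst, fock_comp, fockForm_apply]

end Substitution

/-! ### Schur's lemma for a multiplicity-free action -/

section Schur

open MvPolynomial

variable {V : Type*} [NormedAddCommGroup V] [InnerProductSpace ℂ V]

theorem polyRep_apply (K : Subgroup (V ≃ₗᵢ[ℂ] V)) (k : K) (f : V → ℂ) :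
    polyRep K k f = f ∘ ((k⁻¹ : K) : V ≃ₗᵢ[ℂ] V) := rfl

variable {K : Subgroup (V ≃ₗᵢ[ℂ] V)} {Λ : Type*} {P : Λ → Subrepresentation (polyRep K)}

theorem IsMultiplicityFreeDecomposition.le_holPoly (hP : IsMultiplicityFreeDecomposition K P)
    (a : Λ) : (P a).toSubmodule ≤ Subalgebra.toSubmodule (holPoly V) := by
  rw [← hP.iSup_eq]
  exact le_iSup (fun a => (P a).toSubmodule) a

variable [FiniteDimensional ℂ V]

/-- The polynomial behind a polynomial function. -/
def liftPoly (W : Submodule ℂ (V → ℂ)) (hW : W ≤ Subalgebra.toSubmodule (holPoly V)) :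
    W →ₗ[ℂ] MvPolynomial (Fin (Module.finrank ℂ V)) ℂ :=
  (LinearEquiv.ofInjective (evalPoly V).toLinearMap evalPoly_injective).symm.toLinearMap ∘ₗ
    Submodule.inclusion (hW.trans (by
      rw [← range_evalPoly]
      rintro _ ⟨F, rfl⟩
      exact ⟨F, rfl⟩))

theorem evalPoly_liftPoly (W : Submodule ℂ (V → ℂ))
    (hW : W ≤ Subalgebra.toSubmodule (holPoly V)) (f : W) :
    evalPoly V (liftPoly W hW f) = f := by
  have := LinearEquiv.apply_symm_apply
    (LinearEquiv.ofInjective (evalPoly V).toLinearMap evalPoly_injective)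
    (Submodule.inclusion (hW.trans (by
      rw [← range_evalPoly]
      rintro _ ⟨F, rfl⟩
      exact ⟨F, rfl⟩)) f)
  exact congrArg Subtype.val this

variable [MeasurableSpace V] [BorelSpace V]

theorem IsFockONB.mem {W : Submodule ℂ (V → ℂ)} {v : Fin (Module.finrank ℂ W) → V → ℂ}
    (hv : IsFockONB W v) (i : Fin (Module.finrank ℂ W)) : v i ∈ W := by
  have := Submodule.subset_span (R := ℂ) (Set.mem_range_self (f := v) i)
  rwa [hv.span_eq] at this

theorem IsFockONB.eq_sum {W : Submodule ℂ (V → ℂ)} {v : Fin (Module.finrank ℂ W) → V → ℂ}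
    (hv : IsFockONB W v) (hW : W ≤ Subalgebra.toSubmodule (holPoly V)) {f : V → ℂ} (hf : f ∈ W) :
    f = ∑ j, fock f (v j) • v j := by
  have hmem : ∀ i, v i ∈ subgaussian V := fun i => holPoly_le_subgaussian (hW (hv.mem i))
  rw [← hv.span_eq, Submodule.mem_span_range_iff_exists_fun] at hf
  obtain ⟨c, rfl⟩ := hf
  refine Finset.sum_congr rfl fun j _ => ?_
  rw [fock_sum_left _ (fun i _ => Subalgebra.smul_mem _ (hmem i) _) (hmem j)]
  simp [fock_smul_left, hv.orthonormal]

/-- A form on polynomials that is invariant under `K` is represented by an intertwining operator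
from `P a` to `P b`, so that Schur's lemma applies to it. -/
theorem IsMultiplicityFreeDecomposition.exists_intertwiningMap
    (hP : IsMultiplicityFreeDecomposition K P)
    (a : Λ) {b : Λ} {v : Fin (Module.finrank ℂ (P b).toSubmodule) → V → ℂ}
    (hv : IsFockONB (P b).toSubmodule v) {S : SesqForm (Fin (Module.finrank ℂ V)) ℂ}
    (hS : IsInvariantForm K S) :
    ∃ T : Representation.IntertwiningMap (P a).toRepresentation (P b).toRepresentation,
      ∀ F G, ∀ hF : evalPoly V F ∈ (P a).toSubmodule, evalPoly V G ∈ (P b).toSubmodule →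
        S F G = fock (T ⟨evalPoly V F, hF⟩ : (P b).toSubmodule) (evalPoly V G) := by
  have hb := hP.le_holPoly b
  have hsub : ∀ f ∈ (P b).toSubmodule, f ∈ subgaussian V := fun f hf =>
    holPoly_le_subgaussian (hb hf)
  let w : Fin (Module.finrank ℂ (P b).toSubmodule) → MvPolynomial (Fin (Module.finrank ℂ V)) ℂ :=
    fun j => liftPoly _ hb ⟨v j, hv.mem j⟩
  have hw : ∀ j, evalPoly V (w j) = v j := fun j => evalPoly_liftPoly _ hb ⟨v j, hv.mem j⟩
  let T : (P a).toSubmodule →ₗ[ℂ] (P b).toSubmodule :=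
    ∑ j, LinearMap.toSpanSingleton ℂ (P b).toSubmodule ⟨v j, hv.mem j⟩ ∘ₗ
      (S.flip (w j)) ∘ₗ liftPoly _ (hP.le_holPoly a)
  have hT : ∀ F G, ∀ hF : evalPoly V F ∈ (P a).toSubmodule, evalPoly V G ∈ (P b).toSubmodule →
        S F G = fock (T ⟨evalPoly V F, hF⟩ : (P b).toSubmodule) (evalPoly V G) := by
    intro F G hF hG
    have hF' : liftPoly _ (hP.le_holPoly a) ⟨evalPoly V F, hF⟩ = F :=
      evalPoly_injective (evalPoly_liftPoly _ _ _)
    have h1 : ((T ⟨evalPoly V F, hF⟩ : (P b).toSubmodule) : V → ℂ) = ∑ j, S F (w j) • v j := by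
      simp only [T, LinearMap.sum_apply, LinearMap.comp_apply, hF', LinearMap.flip_apply,
        LinearMap.toSpanSingleton_apply, Submodule.coe_sum, Submodule.coe_smul]
    have h2 : G = ∑ j, fock (evalPoly V G) (v j) • w j := by
      apply evalPoly_injective
      rw [map_sum]
      simp only [map_smul, hw]
      exact hv.eq_sum hb hG
    rw [h1, fock_sum_left _ (fun i _ => Subalgebra.smul_mem _ (hsub _ (hv.mem i)) _) (hsub _ hG)]
    conv_lhs => rw [h2]
    simp only [map_sum, map_smulₛₗ, smul_eq_mul, fock_smul_left, fock_conj_symm, mul_comm]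
  refine ⟨T.intertwiningMap_of_isIntertwiningMap _ _ fun k f => ?_, hT⟩
  obtain ⟨f, hf⟩ := f
  obtain ⟨F, rfl⟩ : ∃ F, evalPoly V F = f :=
    ⟨_, evalPoly_liftPoly _ (hP.le_holPoly a) ⟨f, hf⟩⟩
  apply Subtype.ext
  rw [hv.eq_sum hb (T _).2, hv.eq_sum hb (Subtype.prop ((P b).toRepresentation k _))]
  refine Finset.sum_congr rfl fun j _ => ?_
  congr 1
  have hkF : evalPoly V (subst ((k⁻¹ : K) : V ≃ₗᵢ[ℂ] V) F) = polyRep K k (evalPoly V F) :=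
    evalPoly_subst _ _
  have hkF' : evalPoly V (subst ((k⁻¹ : K) : V ≃ₗᵢ[ℂ] V) F) ∈ (P a).toSubmodule := by
    rw [hkF]
    exact (P a).apply_mem_toSubmodule k hf
  have hkw : evalPoly V (subst ((k : K) : V ≃ₗᵢ[ℂ] V) (w j)) = polyRep K k⁻¹ (v j) := by
    rw [evalPoly_subst, hw, polyRep_apply, inv_inv]
  have hkw' : evalPoly V (subst ((k : K) : V ≃ₗᵢ[ℂ] V) (w j)) ∈ (P b).toSubmodule := by
    rw [hkw]
    exact (P b).apply_mem_toSubmodule k⁻¹ (hv.mem j)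
  have hwj : evalPoly V (w j) ∈ (P b).toSubmodule := by
    rw [hw]
    exact hv.mem j
  have e1 : (P a).toRepresentation k ⟨evalPoly V F, hf⟩ =
      ⟨evalPoly V (subst ((k⁻¹ : K) : V ≃ₗᵢ[ℂ] V) F), hkF'⟩ := Subtype.ext hkF.symm
  have h1 := hT _ (w j) hkF' hwj
  have h2 := hT F _ hf hkw'
  have h3 : S (subst ((k⁻¹ : K) : V ≃ₗᵢ[ℂ] V) F) (w j) =
      S F (subst ((k : K) : V ≃ₗᵢ[ℂ] V) (w j)) := by
    have hkk : subst ((k : K) : V ≃ₗᵢ[ℂ] V) (subst ((k⁻¹ : K) : V ≃ₗᵢ[ℂ] V) F) = F := by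
      apply evalPoly_injective (V := V)
      rw [evalPoly_subst, evalPoly_subst]
      ext z
      simp
    rw [← hS _ k.2, hkk]
  rw [e1, ← hw j, ← h1, h3, h2, evalPoly_subst, hw]
  rw [← fock_comp (((k⁻¹ : K) : V ≃ₗᵢ[ℂ] V))]
  congr 1
  ext z
  simp

/-- Schur's lemma for an invariant form on two inequivalent constituents. -/
theorem IsMultiplicityFreeDecomposition.form_eq_zero (hP : IsMultiplicityFreeDecomposition K P)
    {a b : Λ} (hab : a ≠ b) {v : Fin (Module.finrank ℂ (P b).toSubmodule) → V → ℂ}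
    (hv : IsFockONB (P b).toSubmodule v) {S : SesqForm (Fin (Module.finrank ℂ V)) ℂ}
    (hS : IsInvariantForm K S) {F G : MvPolynomial (Fin (Module.finrank ℂ V)) ℂ}
    (hF : evalPoly V F ∈ (P a).toSubmodule) (hG : evalPoly V G ∈ (P b).toSubmodule) :
    S F G = 0 := by
  obtain ⟨T, hT⟩ := hP.exists_intertwiningMap a hv hS
  have := hP.irreducible a
  have := hP.irreducible b
  have := hP.inequivalent a b hab
  rw [hT F G hF hG, Subsingleton.elim T 0]
  exact fock_zero_left _

/-- Schur's lemma for an invariant form on one constituent. -/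
theorem IsMultiplicityFreeDecomposition.exists_form_eq (hP : IsMultiplicityFreeDecomposition K P)
    {a : Λ} {v : Fin (Module.finrank ℂ (P a).toSubmodule) → V → ℂ}
    (hv : IsFockONB (P a).toSubmodule v) {S : SesqForm (Fin (Module.finrank ℂ V)) ℂ}
    (hS : IsInvariantForm K S) :
    ∃ c : ℂ, ∀ F G, evalPoly V F ∈ (P a).toSubmodule → evalPoly V G ∈ (P a).toSubmodule →
      S F G = c * fockForm V F G := by
  obtain ⟨T, hT⟩ := hP.exists_intertwiningMap a hv hS
  have := hP.irreducible a
  have := hP.finiteDimensional a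
  obtain ⟨c, rfl⟩ :=
    (Representation.IsIrreducible.algebraMap_intertwiningMap_bijective_of_isAlgClosed
      (k := ℂ) (ρ := (P a).toRepresentation)).2 T
  refine ⟨c, fun F G hF hG => ?_⟩
  rw [hT F G hF hG, fockForm_apply, ← fock_smul_left]
  rfl

end Schur

/-! ### The orthonormal system of a multiplicity-free decomposition -/

section Decomposition

open MvPolynomial

variable {V : Type*} [NormedAddCommGroup V] [InnerProductSpace ℂ V]
  {K : Subgroup (V ≃ₗᵢ[ℂ] V)} {Λ : Type*} {P : Λ → Subrepresentation (polyRep K)}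

theorem finrank_pos_of_decomposition (hP : IsMultiplicityFreeDecomposition K P) (a : Λ) :
    0 < Module.finrank ℂ (P a).toSubmodule := by
  have := hP.finiteDimensional a
  by_contra h0
  have h1 : Subsingleton (P a).toSubmodule :=
    Module.finrank_zero_iff.1 (Nat.eq_zero_of_not_pos h0)
  have h2 := (hP.irreducible a).toNontrivial
  obtain ⟨x, y, hxy⟩ := h2
  exact hxy (Subrepresentation.toSubmodule_injective (Subsingleton.elim _ _))

variable [FiniteDimensional ℂ V] [MeasurableSpace V] [BorelSpace V]
  (hP : IsMultiplicityFreeDecomposition K P)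
  {v : ∀ a, Fin (Module.finrank ℂ (P a).toSubmodule) → V → ℂ}
  (hv : ∀ a, IsFockONB (P a).toSubmodule (v a))

/-- The polynomials behind the orthonormal bases of the spaces `P a`. -/
def basisPoly (a : Λ) (i : Fin (Module.finrank ℂ (P a).toSubmodule)) :
    MvPolynomial (Fin (Module.finrank ℂ V)) ℂ :=
  liftPoly _ (hP.le_holPoly a) ⟨v a i, (hv a).mem i⟩

theorem evalPoly_basisPoly (a : Λ) (i : Fin (Module.finrank ℂ (P a).toSubmodule)) :
    evalPoly V (basisPoly hP hv a i) = v a i := evalPoly_liftPoly _ _ _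

theorem evalPoly_basisPoly_mem (a : Λ) (i : Fin (Module.finrank ℂ (P a).toSubmodule)) :
    evalPoly V (basisPoly hP hv a i) ∈ (P a).toSubmodule := by
  rw [evalPoly_basisPoly]
  exact (hv a).mem i

theorem basisPoly_orthonormal (a : Λ) (i j : Fin (Module.finrank ℂ (P a).toSubmodule)) :
    fockForm V (basisPoly hP hv a i) (basisPoly hP hv a j) = if i = j then 1 else 0 := by
  rw [fockForm_apply, evalPoly_basisPoly, evalPoly_basisPoly, (hv a).orthonormal]

theorem basisPoly_orthogonal {a b : Λ} (hab : a ≠ b)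
    (i : Fin (Module.finrank ℂ (P a).toSubmodule)) (j : Fin (Module.finrank ℂ (P b).toSubmodule)) :
    fockForm V (basisPoly hP hv a i) (basisPoly hP hv b j) = 0 :=
  hP.form_eq_zero hab (hv b) (isInvariantForm_fockForm K) (evalPoly_basisPoly_mem hP hv a i)
    (evalPoly_basisPoly_mem hP hv b j)

theorem span_basisPoly :
    Submodule.span ℂ (Set.range fun s : Σ a, Fin (Module.finrank ℂ (P a).toSubmodule) =>
      basisPoly hP hv s.1 s.2) = ⊤ := by
  apply Submodule.map_injective_of_injective (f := (evalPoly V).toLinearMap) evalPoly_injective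
  rw [Submodule.map_top, Submodule.map_span]
  have h1 : LinearMap.range (evalPoly V).toLinearMap = Subalgebra.toSubmodule (holPoly V) := by
    rw [← range_evalPoly]
    rfl
  rw [h1, ← hP.iSup_eq]
  apply le_antisymm
  · rw [Submodule.span_le]
    rintro _ ⟨_, ⟨⟨a, i⟩, rfl⟩, rfl⟩
    exact le_iSup (fun a => (P a).toSubmodule) a (evalPoly_basisPoly_mem hP hv a i)
  · refine iSup_le fun a => ?_
    rw [← (hv a).span_eq]
    refine Submodule.span_mono ?_
    rintro _ ⟨i, rfl⟩
    exact ⟨_, ⟨⟨a, i⟩, rfl⟩, evalPoly_basisPoly hP hv a i⟩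

/-- A polynomial that is orthogonal to all basis polynomials vanishes. -/
theorem eq_zero_of_fockForm_basisPoly {F : MvPolynomial (Fin (Module.finrank ℂ V)) ℂ}
    (hF : ∀ a i, fockForm V F (basisPoly hP hv a i) = 0) : F = 0 := by
  classical
  have hmem : F ∈ Submodule.span ℂ
      (Set.range fun s : Σ a, Fin (Module.finrank ℂ (P a).toSubmodule) =>
        basisPoly hP hv s.1 s.2) := by
    rw [span_basisPoly]
    trivial
  rw [Finsupp.mem_span_range_iff_exists_finsupp] at hmem
  obtain ⟨c, rfl⟩ := hmem
  refine Finset.sum_eq_zero fun s hs => ?_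
  have h1 := hF s.1 s.2
  rw [Finsupp.sum, map_sum, LinearMap.sum_apply, Finset.sum_eq_single s] at h1
  · rw [map_smul, LinearMap.smul_apply, basisPoly_orthonormal, if_pos rfl, smul_eq_mul,
      mul_one] at h1
    simp only [h1, zero_smul]
  · rintro ⟨b, j⟩ _ hne
    obtain ⟨a, i⟩ := s
    rw [map_smul, LinearMap.smul_apply]
    by_cases hba : b = a
    · subst hba
      rw [basisPoly_orthonormal, if_neg, smul_zero]
      rintro rfl
      exact hne rfl
    · rw [basisPoly_orthogonal hP hv hba, smul_zero]
  · exact fun h => absurd hs h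

theorem basisPoly_ne_zero (a : Λ) (i : Fin (Module.finrank ℂ (P a).toSubmodule)) :
    basisPoly hP hv a i ≠ 0 := by
  intro h0
  have h1 := basisPoly_orthonormal hP hv a i i
  rw [h0, map_zero, if_pos rfl] at h1
  exact zero_ne_one h1

/-- The members of `P a` are homogeneous of the same degree: by Schur's lemma the scaling
`z ↦ 2 z` acts on `P a` by a scalar. -/
theorem exists_isHomogeneous_basisPoly (a : Λ) :
    ∃ m, ∀ i, (basisPoly hP hv a i).IsHomogeneous m := by
  have hS := isInvariantForm_scale (isInvariantForm_fockForm K) 2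
  obtain ⟨c, hc⟩ := hP.exists_form_eq (hv a) hS
  have hscale : ∀ i, scale 2 (basisPoly hP hv a i) = c • basisPoly hP hv a i := fun i => by
    rw [← sub_eq_zero]
    refine eq_zero_of_fockForm_basisPoly hP hv fun b j => ?_
    rw [map_sub, map_smul, LinearMap.sub_apply, LinearMap.smul_apply, sub_eq_zero]
    by_cases hab : a = b
    · subst hab
      exact hc _ _ (evalPoly_basisPoly_mem hP hv a i) (evalPoly_basisPoly_mem hP hv a j)
    · rw [basisPoly_orthogonal hP hv hab, smul_zero]
      exact hP.form_eq_zero hab (hv b) hS (evalPoly_basisPoly_mem hP hv a i)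
        (evalPoly_basisPoly_mem hP hv b j)
  have hcoeff : ∀ i s, coeff s (basisPoly hP hv a i) ≠ 0 → (2 : ℂ) ^ s.degree = c := by
    intro i s hs
    have := congrArg (coeff s) (hscale i)
    rw [coeff_scale, coeff_smul, smul_eq_mul] at this
    exact mul_right_cancel₀ hs this
  let i₀ : Fin (Module.finrank ℂ (P a).toSubmodule) := ⟨0, finrank_pos_of_decomposition hP a⟩
  obtain ⟨s₀, hs₀⟩ := MvPolynomial.ne_zero_iff.1 (basisPoly_ne_zero hP hv a i₀)
  refine ⟨s₀.degree, fun i s hs => ?_⟩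
  have h1 : (2 : ℂ) ^ s.degree = 2 ^ s₀.degree := by rw [hcoeff i s hs, hcoeff i₀ s₀ hs₀]
  have h2 : (2 : ℕ) ^ s.degree = 2 ^ s₀.degree := by exact_mod_cast h1
  have h3 := Nat.pow_right_injective le_rfl h2
  rw [← h3, Finsupp.degree_eq_weight_one]
  rfl

theorem homDegree_eq {a : Λ} {m : ℕ} (hm : ∀ i, (basisPoly hP hv a i).IsHomogeneous m) :
    homDegree (P a).toSubmodule = m := by
  have h1 : ∀ i (c : ℂ) (z : V), v a i (c • z) = c ^ m * v a i z := fun i c z => by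
    rw [← evalPoly_basisPoly hP hv, ← evalPoly_scale, scale_eq_of_isHomogeneous c (hm i), map_smul]
    rfl
  let i₀ : Fin (Module.finrank ℂ (P a).toSubmodule) := ⟨0, finrank_pos_of_decomposition hP a⟩
  have h2 : ∃ z, v a i₀ z ≠ 0 := by
    by_contra h0
    push Not at h0
    refine basisPoly_ne_zero hP hv a i₀ (evalPoly_injective (V := V) ?_)
    rw [evalPoly_basisPoly, map_zero]
    exact funext h0
  have h3 : {m : ℕ | ∀ f ∈ (P a).toSubmodule, ∀ (c : ℂ) (z : V), f (c • z) = c ^ m * f z} =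
      {m} := by
    ext m'
    simp only [Set.mem_ofPred_eq, Set.mem_singleton_iff]
    constructor
    · intro h
      obtain ⟨z, hz⟩ := h2
      have h4 := (h _ ((hv a).mem i₀) 2 z).symm.trans (h1 i₀ 2 z)
      have h5 : (2 : ℕ) ^ m' = 2 ^ m := by exact_mod_cast mul_right_cancel₀ hz h4
      exact Nat.pow_right_injective le_rfl h5
    · rintro rfl f hf c z
      rw [← (hv a).span_eq] at hf
      induction hf using Submodule.span_induction with
      | mem f hf =>
        obtain ⟨i, rfl⟩ := hf
        exact h1 i c z
      | zero => simp
      | add f g _ _ hf hg => rw [Pi.add_apply, Pi.add_apply, hf, hg, mul_add]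
      | smul x f _ hf =>
        rw [Pi.smul_apply, Pi.smul_apply, hf, smul_eq_mul, smul_eq_mul]
        ring
  rw [homDegree, h3, csInf_singleton]

include hP hv in
/-- If `V = 0`, then the polynomials are the constants, which have only one constituent. -/
theorem finrank_pos_of_infinite [Infinite Λ] : 0 < Module.finrank ℂ V := by
  by_contra h0
  have h1 : IsEmpty (Fin (Module.finrank ℂ V)) := by
    rw [Nat.eq_zero_of_not_pos h0]
    infer_instance
  obtain ⟨a, b, hab⟩ := exists_pair_ne Λ
  have key := basisPoly_orthogonal hP hv hab ⟨0, finrank_pos_of_decomposition hP a⟩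
    ⟨0, finrank_pos_of_decomposition hP b⟩
  have ha := basisPoly_ne_zero hP hv a ⟨0, finrank_pos_of_decomposition hP a⟩
  have hb := basisPoly_ne_zero hP hv b ⟨0, finrank_pos_of_decomposition hP b⟩
  rw [eq_C_of_isEmpty (basisPoly hP hv a _)] at ha key
  rw [eq_C_of_isEmpty (basisPoly hP hv b _)] at hb key
  rw [isFockForm_fockForm.C_C, mul_eq_zero, map_eq_zero] at key
  rcases key with h | h
  · exact ha (by rw [h, C_0])
  · exact hb (by rw [h, C_0])

theorem fockForm_subst_left (k : V ≃ₗᵢ[ℂ] V) (F G : MvPolynomial (Fin (Module.finrank ℂ V)) ℂ) :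
    fockForm V (subst k F) G = fockForm V F (subst k.symm G) := by
  rw [fockForm_apply, fockForm_apply, evalPoly_subst, evalPoly_subst, ← fock_comp k (evalPoly V F)]
  congr 1
  ext z
  simp

theorem projForm_of_mem_right {a : Λ} {F G : MvPolynomial (Fin (Module.finrank ℂ V)) ℂ}
    (hG : evalPoly V G ∈ (P a).toSubmodule) :
    projForm (fockForm V) (basisPoly hP hv a) F G = fockForm V F G := by
  have h1 : G = ∑ j, fockForm V G (basisPoly hP hv a j) • basisPoly hP hv a j := by
    apply evalPoly_injective
    rw [map_sum]
    simp only [map_smul, fockForm_apply, evalPoly_basisPoly]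
    exact (hv a).eq_sum (hP.le_holPoly a) hG
  conv_rhs => rw [h1]
  rw [projForm_apply, map_sum]
  refine Finset.sum_congr rfl fun j _ => ?_
  rw [map_smulₛₗ, isFockForm_fockForm.conj_symm, smul_eq_mul, mul_comm]

theorem projForm_of_mem_left {a : Λ} {F G : MvPolynomial (Fin (Module.finrank ℂ V)) ℂ}
    (hF : evalPoly V F ∈ (P a).toSubmodule) :
    projForm (fockForm V) (basisPoly hP hv a) F G = fockForm V F G := by
  rw [← isFockForm_fockForm.conj_symm, ← projForm_of_mem_right hP hv hF, projForm_apply,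
    projForm_apply, map_sum]
  simp only [map_mul, isFockForm_fockForm.conj_symm, mul_comm]

/-- The orthogonal projection onto `P a` commutes with `K`. -/
theorem isInvariantForm_projForm (a : Λ) :
    IsInvariantForm K (projForm (fockForm V) (basisPoly hP hv a)) := by
  intro k hk F G
  set u := basisPoly hP hv a with hu
  have hsub : ∀ k ∈ K, ∀ i, evalPoly V (subst k (u i)) ∈ (P a).toSubmodule := by
    intro k hk i
    have := (P a).apply_mem_toSubmodule ⟨k, hk⟩⁻¹ (evalPoly_basisPoly_mem hP hv a i)
    rwa [polyRep_apply, inv_inv, ← evalPoly_subst] at this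
  have hk' : k.symm ∈ K := K.inv_mem hk
  calc projForm (fockForm V) u (subst k F) (subst k G)
      = ∑ j, fockForm V F (subst k.symm (u j)) * fockForm V (u j) (subst k G) := by
        simp only [projForm_apply, fockForm_subst_left k F]
    _ = ∑ j, (∑ l, fockForm V F (u l) * fockForm V (subst k (u l)) (u j)) *
          fockForm V (u j) (subst k G) := by
        refine Finset.sum_congr rfl fun j _ => ?_
        rw [← projForm_of_mem_right hP hv (hsub _ hk' j), projForm_apply]
        simp only [fockForm_subst_left k, ← hu]
    _ = ∑ l, fockForm V F (u l) * projForm (fockForm V) u (subst k (u l)) (subst k G) := by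
        simp only [projForm_apply, Finset.sum_mul, Finset.mul_sum]
        rw [Finset.sum_comm]
        simp only [mul_assoc]
    _ = projForm (fockForm V) u F G := by
        rw [projForm_apply]
        refine Finset.sum_congr rfl fun l _ => ?_
        rw [projForm_of_mem_left hP hv (hsub k hk l), isInvariantForm_fockForm K k hk]

variable {deg : Λ → ℕ} (hdeg : ∀ a, deg a = homDegree (P a).toSubmodule)
include hdeg

theorem isHomogeneous_basisPoly (a : Λ) (i : Fin (Module.finrank ℂ (P a).toSubmodule)) :
    (basisPoly hP hv a i).IsHomogeneous (deg a) := by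
  obtain ⟨m, hm⟩ := exists_isHomogeneous_basisPoly hP hv a
  rw [hdeg, homDegree_eq hP hv hm]
  exact hm i

include hP hv

/-- Every degree occurs, since the power `X i ^ m` has a component in degree `m`. -/
theorem exists_deg_eq [Nonempty (Fin (Module.finrank ℂ V))] (m : ℕ) : ∃ a, deg a = m := by
  by_contra h0
  push Not at h0
  obtain ⟨i⟩ := ‹Nonempty (Fin (Module.finrank ℂ V))›
  have h1 : ∀ F : MvPolynomial (Fin (Module.finrank ℂ V)) ℂ, homogeneousComponent m F = 0 := by
    intro F
    have hF : F ∈ Submodule.span ℂ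
        (Set.range fun s : Σ a, Fin (Module.finrank ℂ (P a).toSubmodule) =>
          basisPoly hP hv s.1 s.2) := by
      rw [span_basisPoly]
      trivial
    induction hF using Submodule.span_induction with
    | mem F hF =>
      obtain ⟨⟨a, j⟩, rfl⟩ := hF
      rw [homogeneousComponent_of_mem
        ((mem_homogeneousSubmodule _ _).2 (isHomogeneous_basisPoly hP hv hdeg a j)),
        if_neg (fun h => h0 a h.symm)]
    | zero => simp
    | add F G _ _ hF hG => rw [map_add, hF, hG, add_zero]
    | smul c F _ hF => rw [map_smul, hF, smul_zero]
  have h2 := h1 (X i ^ m)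
  rw [homogeneousComponent_of_mem ((mem_homogeneousSubmodule _ _).2 (isHomogeneous_X_pow i m)),
    if_pos rfl] at h2
  exact pow_ne_zero m (X_ne_zero i) h2

/-- Levels are finite, since there are members of higher degree, which come later in the
enumeration. -/
theorem finite_level (e : ℕ ≃ Λ) (he : ∀ i j, deg (e i) < deg (e j) → i < j) (m : ℕ) :
    {a | deg a = m}.Finite := by
  have : Infinite Λ := e.infinite_iff.1 inferInstance
  have : Nonempty (Fin (Module.finrank ℂ V)) := ⟨⟨0, finrank_pos_of_infinite hP hv⟩⟩
  obtain ⟨b, hb⟩ := exists_deg_eq hP hv hdeg (m + 1)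
  refine ((Set.finite_Iio (e.symm b)).image e).subset fun a ha => ⟨e.symm a, ?_, by simp⟩
  refine he _ _ ?_
  rw [e.apply_symm_apply, e.apply_symm_apply, hb, show deg a = m from ha]
  exact Nat.lt_succ_self m

theorem isMultFreeSystem (e : ℕ ≃ Λ) (he : ∀ i j, deg (e i) < deg (e j) → i < j) :
    IsMultFreeSystem (fockForm V) deg (basisPoly hP hv) where
  form := isFockForm_fockForm
  nonempty := fun a => ⟨⟨0, finrank_pos_of_decomposition hP a⟩⟩
  homogeneous := isHomogeneous_basisPoly hP hv hdeg
  orthonormal := basisPoly_orthonormal hP hv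
  orthogonal := fun a b hab => basisPoly_orthogonal hP hv hab
  span_eq := span_basisPoly hP hv
  finite_level := finite_level hP hv hdeg e he
  schur_ne := fun a k b c hbc i j => hP.form_eq_zero hbc (hv c)
    (isInvariantForm_raise_iterate (isInvariantForm_projForm hP hv a) k)
    (evalPoly_basisPoly_mem hP hv b i) (evalPoly_basisPoly_mem hP hv c j)
  schur_self := fun a k b => by
    obtain ⟨c, hc⟩ := hP.exists_form_eq (hv b)
      (isInvariantForm_raise_iterate (isInvariantForm_projForm hP hv a) k)
    refine ⟨c, fun i j => ?_⟩
    rw [hc _ _ (evalPoly_basisPoly_mem hP hv b i) (evalPoly_basisPoly_mem hP hv b j),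
      basisPoly_orthonormal]
    simp

end Decomposition

/-! ### Gram–Schmidt orthogonalization and binomial coefficients -/

section Orthogonalization

open MvPolynomial

/-- Applying `exp(-Δ)` is compatible with linear maps of the values. -/
theorem hermite_map {σ M N : Type*} [Fintype σ] [AddCommGroup M] [Module ℂ M] [AddCommGroup N]
    [Module ℂ N] (φ : SesqForm σ M) (ψ : SesqForm σ N) (L : M →ₗ[ℂ] N)
    (h : ∀ F G, ψ F G = L (φ F G)) (m : ℕ) (F G : MvPolynomial σ ℂ) :
    hermite ψ m F G = L (hermite φ m F G) := by
  simp only [hermite, map_sum, map_smul]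
  exact Finset.sum_congr rfl fun k _ => by
    rw [contract_iterate_map φ ψ L.toAddMonoidHom h k F G]
    rfl

theorem hermiteAverage_map {σ M N Λ : Type*} {ι : Λ → Type*} [∀ a, Fintype (ι a)] [Fintype σ]
    [AddCommGroup M] [Module ℂ M] [AddCommGroup N] [Module ℂ N] (φ : SesqForm σ M)
    (ψ : SesqForm σ N) (L : M →ₗ[ℂ] N) (h : ∀ F G, ψ F G = L (φ F G)) (deg : Λ → ℕ)
    (u : ∀ a, ι a → MvPolynomial σ ℂ) (a : Λ) :
    hermiteAverage ψ deg u a = L (hermiteAverage φ deg u a) := by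
  simp only [hermiteAverage, map_sum, map_smul, hermite_map φ ψ L h]

variable {V : Type*} [NormedAddCommGroup V] [InnerProductSpace ℂ V] [FiniteDimensional ℂ V]
  [MeasurableSpace V] [BorelSpace V]

/-- An orthogonal sequence that differs from `f` by triangular terms is the Gram–Schmidt
orthogonalization of `f`. -/
theorem fockGramSchmidt_eq {f g : ℕ → V → ℂ} (hg : ∀ k, g k ∈ subgaussian V)
    (horth : ∀ j k, j ≠ k → fock (g j) (g k) = 0) (hne : ∀ k, fock (g k) (g k) ≠ 0)
    (hspan : ∀ k, f k - g k ∈ Submodule.span ℂ (Set.range fun j : Fin k => g j)) (k : ℕ) :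
    fockGramSchmidt f k = g k := by
  induction k using Nat.strong_induction_on with
  | _ k ih =>
    obtain ⟨c, hc⟩ := (Submodule.mem_span_range_iff_exists_fun ℂ).1 (hspan k)
    have hf : f k = g k + ∑ j, c j • g (j : Fin k) := by rw [hc, add_sub_cancel]
    have hcoeff : ∀ j : Fin k, fock (f k) (g j) = c j * fock (g j) (g j) := by
      intro j
      have hmem : ∀ i : Fin k, c i • g i ∈ subgaussian V := fun i =>
        Subalgebra.smul_mem _ (hg i) _
      rw [hf, fock_add_left (hg k) (sum_mem fun i _ => hmem i) (hg j), horth _ _ j.2.ne', zero_add,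
        fock_sum_left _ (fun i _ => hmem i) (hg j), Finset.sum_eq_single j, fock_smul_left]
      · intro i _ hij
        rw [fock_smul_left, horth _ _ (fun h => hij (Fin.ext h)), mul_zero]
      · simp
    rw [fockGramSchmidt]
    simp only [ih _ (Fin.is_lt _), hcoeff, mul_div_cancel_right₀ _ (hne _)]
    rw [hc]
    abel

/-- The form `(F, G) ↦ F * conj G` with values in the functions on `V`. -/
def evalForm (V : Type*) [NormedAddCommGroup V] [InnerProductSpace ℂ V] [FiniteDimensional ℂ V] :
    SesqForm (Fin (Module.finrank ℂ V)) (subgaussian V) :=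
  LinearMap.mk₂'ₛₗ (RingHom.id ℂ) (starRingEnd ℂ)
    (fun F G => ⟨evalPoly V F * fun z => conj (evalPoly V G z),
      mul_mem (evalPoly_mem_subgaussian F) (conj_mem_subgaussian (evalPoly_mem_subgaussian G))⟩)
    (fun F₁ F₂ G => by ext z; simp [add_mul])
    (fun c F G => by ext z; simp [mul_assoc])
    (fun F G₁ G₂ => by ext z; simp [mul_add])
    (fun c F G => by ext z; simp [mul_left_comm])

omit [MeasurableSpace V] [BorelSpace V] in
theorem evalForm_apply (F G : MvPolynomial (Fin (Module.finrank ℂ V)) ℂ) (z : V) :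
    (evalForm V F G).1 z = evalPoly V F z * conj (evalPoly V G z) := rfl

/-- The linear functional `f ↦ ⟨f, g⟩₁`. -/
def fockFunctional (g : subgaussian V) : subgaussian V →ₗ[ℂ] ℂ where
  toFun f := fock f.1 g.1
  map_add' f₁ f₂ := fock_add_left f₁.2 f₂.2 g.2
  map_smul' c f := fock_smul_left c f.1 g.1

theorem fockFunctional_apply (f g : subgaussian V) : fockFunctional g f = fock f.1 g.1 := rfl

theorem fockFunctional_conj_symm (f g : subgaussian V) :
    conj (fockFunctional g f) = fockFunctional f g := fock_conj_symm _ _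

/-- Pairing `F * conj G` with `|w|²`. -/
theorem fockFunctional_evalForm (w F G : MvPolynomial (Fin (Module.finrank ℂ V)) ℂ) :
    mulForm (fockForm V) w w F G = fockFunctional (evalForm V w w) (evalForm V F G) := by
  rw [mulForm_apply, fockForm_apply, fockFunctional_apply, fock, fock]
  congr 2
  ext z
  simp only [map_mul, Pi.mul_apply, evalForm_apply, Complex.conj_conj]
  ring

namespace IsMultFreeSystem

variable {Λ : Type*} {ι : Λ → Type*} [∀ a, Fintype (ι a)] [∀ a, DecidableEq (ι a)]
  {deg : Λ → ℕ} {u : ∀ a, ι a → MvPolynomial (Fin (Module.finrank ℂ V)) ℂ}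
  (h : IsMultFreeSystem (fockForm V) deg u)
include h

theorem hermiteAverage_apply_zero (a : Λ) :
    (hermiteAverage (evalForm V) deg u a).1 0 = (-1) ^ deg a := by
  let L : subgaussian V →ₗ[ℂ] ℂ := LinearMap.proj 0 ∘ₗ (subgaussian V).val.toLinearMap
  let φ : SesqForm (Fin (Module.finrank ℂ V)) ℂ :=
    LinearMap.mk₂'ₛₗ (RingHom.id ℂ) (starRingEnd ℂ)
      (fun F G => constantCoeff F * conj (constantCoeff G))
      (by simp [add_mul]) (by simp [mul_assoc]) (by simp [mul_add])
      (by simp [mul_left_comm])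
  rw [← h.hermiteAverage_constantCoeff φ (fun _ _ => rfl) a]
  refine (hermiteAverage_map (evalForm V) φ L (fun F G => ?_) deg u a).symm
  have h0 : ∀ F : MvPolynomial (Fin (Module.finrank ℂ V)) ℂ,
      evalPoly V F 0 = constantCoeff F := fun F => by
    rw [evalPoly_apply, map_zero]
    exact DFunLike.congr_fun eval_zero' F
  change constantCoeff F * conj (constantCoeff G) = (evalForm V F G).1 0
  rw [evalForm_apply, h0, h0]

theorem fock_hermiteAverage_average {a b : Λ} (hab : deg b ≤ deg a) [Decidable (a = b)] :
    fockFunctional (average (evalForm V) u b) (hermiteAverage (evalForm V) deg u a) =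
      if a = b then 1 / (Fintype.card (ι a) : ℂ) else 0 := by
  have h1 : ∀ i, fockFunctional (evalForm V (u b i) (u b i))
      (hermiteAverage (evalForm V) deg u a) =
        1 / (Fintype.card (ι a) : ℂ) * if a = b then 1 else 0 := fun i => by
    rw [← hermiteAverage_map _ _ _ (fockFunctional_evalForm (u b i)), hermiteAverage,
      h.sum_hermite_mulForm hab, smul_eq_mul]
  rw [← fockFunctional_conj_symm, average, map_smul, map_sum, smul_eq_mul, map_mul, map_sum]
  simp only [fockFunctional_conj_symm, h1]
  rw [Finset.sum_const, Finset.card_univ, nsmul_eq_mul]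
  have := h.card_ne_zero b
  split_ifs
  · simp
    field_simp
  · simp

/-- Pairing with `hermiteAverage` extracts the coefficient of the top degree term. -/
theorem fock_hermiteAverage_linearCombination {a : Λ} (x : Λ →₀ ℂ)
    (hx : ∀ b, deg a < deg b → x b = 0) :
    fockFunctional (Finsupp.linearCombination ℂ (average (evalForm V) u) x)
      (hermiteAverage (evalForm V) deg u a) = conj (x a) / (Fintype.card (ι a) : ℂ) := by
  classical
  rw [← fockFunctional_conj_symm, Finsupp.linearCombination_apply, map_finsuppSum, Finsupp.sum,
    map_sum, Finset.sum_eq_single a]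
  · rw [map_smul, smul_eq_mul, map_mul, fockFunctional_conj_symm,
      h.fock_hermiteAverage_average le_rfl, if_pos rfl, mul_one_div]
  · intro b hb hba
    have hle : deg b ≤ deg a := by
      by_contra hlt
      exact Finsupp.mem_support_iff.1 hb (hx b (not_le.1 hlt))
    rw [map_smul, smul_eq_mul, map_mul, fockFunctional_conj_symm,
      h.fock_hermiteAverage_average hle, if_neg (Ne.symm hba), mul_zero]
  · intro ha
    rw [Finsupp.notMem_support_iff.1 ha, zero_smul, map_zero, map_zero]

theorem fock_hermiteAverage_self (a : Λ) :
    fockFunctional (hermiteAverage (evalForm V) deg u a) (hermiteAverage (evalForm V) deg u a) =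
      1 / (Fintype.card (ι a) : ℂ) := by
  obtain ⟨x, hx, hxa, hx0, -⟩ := h.exists_hermiteAverage_eq (evalForm V) a
  conv_lhs => enter [1]; rw [hx]
  rw [h.fock_hermiteAverage_linearCombination x
    (fun b hb => hx0 b hb.le fun hba => hb.ne (congrArg deg hba.symm)), hxa, map_one]

theorem fock_hermiteAverage_of_ne {a b : Λ} (hab : a ≠ b) :
    fockFunctional (hermiteAverage (evalForm V) deg u b)
      (hermiteAverage (evalForm V) deg u a) = 0 := by
  wlog hle : deg b ≤ deg a generalizing a b
  · rw [← fockFunctional_conj_symm, this hab.symm (not_le.1 hle).le, map_zero]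
  obtain ⟨x, hx, -, hx0, -⟩ := h.exists_hermiteAverage_eq (evalForm V) b
  rw [hx, h.fock_hermiteAverage_linearCombination, hx0 a hle hab, map_zero, zero_div]
  intro c hc
  refine hx0 c (hle.trans hc.le) ?_
  rintro rfl
  exact hle.not_gt hc

theorem linearIndependent_average : LinearIndependent ℂ (average (evalForm V) u) := by
  rw [linearIndependent_iff]
  intro x hx
  by_contra h0
  obtain ⟨a, ha, hmax⟩ := x.support.exists_max_image deg (Finsupp.support_nonempty_iff.2 h0)
  have h1 := h.fock_hermiteAverage_linearCombination (a := a) x fun b hb => by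
    by_contra hb0
    exact (hmax b (Finsupp.mem_support_iff.2 hb0)).not_gt hb
  rw [hx, ← fockFunctional_conj_symm, map_zero, map_zero, eq_comm,
    div_eq_zero_iff, map_eq_zero] at h1
  exact h1.elim (Finsupp.mem_support_iff.1 ha) (h.card_ne_zero a)

/-- The triangular relation between the `p_a` and the `exp(-Δ) p_a` can be inverted. -/
theorem average_sub_hermiteAverage_mem_span (a : Λ) :
    average (evalForm V) u a - hermiteAverage (evalForm V) deg u a ∈
      Submodule.span ℂ (hermiteAverage (evalForm V) deg u '' {b | deg b < deg a}) := by
  induction hm : deg a using Nat.strong_induction_on generalizing a with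
  | _ m ih =>
    obtain ⟨x, hx, hxa, hx0, -⟩ := h.exists_hermiteAverage_eq (evalForm V) a
    have h1 : average (evalForm V) u a - hermiteAverage (evalForm V) deg u a =
        -Finsupp.linearCombination ℂ (average (evalForm V) u) (x - Finsupp.single a 1) := by
      rw [map_sub, ← hx, Finsupp.linearCombination_single, one_smul, neg_sub]
    rw [h1]
    refine neg_mem (Submodule.sum_mem _ fun b hb => Submodule.smul_mem _ _ ?_)
    have hlt : deg b < m := by
      by_contra hlt
      rw [not_lt, ← hm] at hlt
      refine Finsupp.mem_support_iff.1 hb ?_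
      rw [Finsupp.sub_apply]
      by_cases hba : b = a
      · rw [hba, hxa, Finsupp.single_eq_same, sub_self]
      · rw [hx0 b hlt hba, Finsupp.single_eq_of_ne hba, sub_zero]
    rw [← sub_add_cancel (average (evalForm V) u b) (hermiteAverage (evalForm V) deg u b)]
    refine add_mem (Submodule.span_mono (Set.image_mono fun c hc => ?_) (ih _ hlt b rfl))
      (Submodule.subset_span ⟨b, hlt, rfl⟩)
    exact lt_trans hc hlt

/-- The Gram–Schmidt orthogonalization of the invariant polynomials `p_a` is `exp(-Δ) p_a`. -/
theorem fockGramSchmidt_average (e : ℕ ≃ Λ) (he : ∀ i j, deg (e i) < deg (e j) → i < j) (k : ℕ) :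
    fockGramSchmidt ((fun a => (average (evalForm V) u a).1) ∘ e) k =
      (hermiteAverage (evalForm V) deg u (e k)).1 := by
  refine fockGramSchmidt_eq (g := fun k => (hermiteAverage (evalForm V) deg u (e k)).1)
    (fun k => Subtype.coe_prop _) (fun j k hjk => ?_) (fun k => ?_) (fun k => ?_) k
  · exact h.fock_hermiteAverage_of_ne (e.injective.ne hjk)
  · have h1 := h.fock_hermiteAverage_self (e k)
    rw [fockFunctional_apply] at h1
    rw [h1]
    exact one_div_ne_zero (h.card_ne_zero _)
  · have h1 := Submodule.mem_map_of_mem (f := (subgaussian V).val.toLinearMap)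
      (h.average_sub_hermiteAverage_mem_span (e k))
    rw [Submodule.map_span] at h1
    refine Submodule.span_mono ?_ h1
    rintro _ ⟨_, ⟨b, hb, rfl⟩, rfl⟩
    refine ⟨⟨e.symm b, he _ _ (by simpa using hb)⟩, ?_⟩
    simp

theorem orthPoly_average (e : ℕ ≃ Λ) (he : ∀ i j, deg (e i) < deg (e j) → i < j) (a : Λ) :
    orthPoly (fun a => (average (evalForm V) u a).1) e a =
      ((-1 : ℂ) ^ deg a • hermiteAverage (evalForm V) deg u a).1 := by
  rw [orthPoly, h.fockGramSchmidt_average e he, e.apply_symm_apply, h.hermiteAverage_apply_zero,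
    ← inv_pow, inv_neg, inv_one]
  rfl

/-- The generalized binomial coefficients of neighbouring degrees are, up to the dimension, sums of
squares. -/
theorem genBinom_average (e : ℕ ≃ Λ) (he : ∀ i j, deg (e i) < deg (e j) → i < j) {a b : Λ}
    (hab : deg a = deg b + 1) :
    genBinom deg (fun a => (average (evalForm V) u a).1) e a b =
      neighbourWeight (fockForm V) u a b / Fintype.card (ι a) := by
  obtain ⟨x, hx, -, -, hx1⟩ := h.exists_hermiteAverage_eq (evalForm V) a
  have hinj : Function.Injective
      (Finsupp.linearCombination ℂ fun a => (average (evalForm V) u a).1) := by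
    have := h.linearIndependent_average.map' (subgaussian V).val.toLinearMap
      (LinearMap.ker_eq_bot.2 Subtype.val_injective)
    exact this
  have hq : orthPoly (fun a => (average (evalForm V) u a).1) e a =
      Finsupp.linearCombination ℂ (fun a => (average (evalForm V) u a).1)
        ((-1 : ℂ) ^ deg a • x) := by
    rw [h.orthPoly_average e he, hx, ← map_smul]
    exact Finsupp.apply_linearCombination ℂ (subgaussian V).val.toLinearMap _ _
  rw [genBinom, if_pos (by omega), hq, Function.leftInverse_invFun hinj, Finsupp.smul_apply,
    hx1 b hab, hab, smul_eq_mul, pow_succ]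
  have h1 : ((-1 : ℂ) ^ deg b * -1 *
      -(neighbourWeight (fockForm V) u a b / Fintype.card (ι a) : ℂ)) =
      (((-1) ^ deg b * (neighbourWeight (fockForm V) u a b / Fintype.card (ι a)) : ℝ) : ℂ) := by
    push_cast
    ring
  rw [h1, Complex.ofReal_re, ← mul_assoc, ← pow_add, Even.neg_one_pow ⟨_, rfl⟩, one_mul]

end IsMultFreeSystem

end Orthogonalization

/-! ### Sums of the rates over the levels -/

section Rates

variable {V : Type*} [NormedAddCommGroup V] [InnerProductSpace ℂ V] [FiniteDimensional ℂ V]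
  [MeasurableSpace V] [BorelSpace V] {K : Subgroup (V ≃ₗᵢ[ℂ] V)} {Λ : Type*}
  {P : Λ → Subrepresentation (polyRep K)} (hP : IsMultiplicityFreeDecomposition K P)
  {v : ∀ a, Fin (Module.finrank ℂ (P a).toSubmodule) → V → ℂ}
  (hv : ∀ a, IsFockONB (P a).toSubmodule (v a))

theorem coe_average_basisPoly (a : Λ) :
    (average (evalForm V) (basisPoly hP hv) a).1 = invPoly (v a) := by
  ext z
  have h1 : ∀ j, (evalForm V (basisPoly hP hv a j) (basisPoly hP hv a j)).1 z =
      v a j z * conj (v a j z) := fun j => by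
    rw [evalForm_apply, evalPoly_basisPoly]
  simp [average, invPoly, Finset.sum_apply, h1]

variable {deg : Λ → ℕ} (hdeg : ∀ a, deg a = homDegree (P a).toSubmodule)
  (e : ℕ ≃ Λ) (he : ∀ i j, deg (e i) < deg (e j) → i < j)
include hP hv hdeg he

theorem genBinom_eq {a b : Λ} (hab : deg a = deg b + 1) :
    genBinom deg (fun a => invPoly (v a)) e a b =
      neighbourWeight (fockForm V) (basisPoly hP hv) a b /
        Module.finrank ℂ (P a).toSubmodule := by
  have := (isMultFreeSystem hP hv hdeg e he).genBinom_average e he hab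
  simpa only [coe_average_basisPoly, Fintype.card_fin] using this

theorem birthRate_eq {a b : Λ} (hab : deg b = deg a + 1) :
    birthRate (Module.finrank ℂ V) deg (fun a => Module.finrank ℂ (P a).toSubmodule)
      (genBinom deg (fun a => invPoly (v a)) e) a b =
      neighbourWeight (fockForm V) (basisPoly hP hv) b a /
        Module.finrank ℂ (P a).toSubmodule := by
  have h0 : (Module.finrank ℂ (P b).toSubmodule : ℝ) ≠ 0 := by
    exact_mod_cast (finrank_pos_of_decomposition hP b).ne'
  rw [birthRate, if_pos hab, genBinom_eq hP hv hdeg e he hab]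
  field_simp

theorem sum_birthRate (a : Λ) :
    ∑ b ∈ (finite_level hP hv hdeg e he (deg a + 1)).toFinset,
      birthRate (Module.finrank ℂ V) deg (fun a => Module.finrank ℂ (P a).toSubmodule)
        (genBinom deg (fun a => invPoly (v a)) e) a b = (Module.finrank ℂ V : ℝ) + deg a := by
  have h0 : (Module.finrank ℂ (P a).toSubmodule : ℝ) ≠ 0 := by
    exact_mod_cast (finrank_pos_of_decomposition hP a).ne'
  have h1 := (isMultFreeSystem hP hv hdeg e he).sum_neighbourWeight_left (b := a)
  have hlevel : ∀ b ∈ (finite_level hP hv hdeg e he (deg a + 1)).toFinset, deg b = deg a + 1 :=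
    fun b hb => by simpa using hb
  rw [Finset.sum_congr rfl fun b hb => birthRate_eq hP hv hdeg e he (hlevel b hb),
    ← Finset.sum_div, h1, Fintype.card_fin, Fintype.card_fin,
    mul_div_cancel_left₀ _ h0]

theorem sum_deathRate (a : Λ) (m : ℕ) (ha : deg a = m + 1) :
    ∑ b ∈ (finite_level hP hv hdeg e he m).toFinset,
      deathRate deg (genBinom deg (fun a => invPoly (v a)) e) a b = deg a := by
  have h0 : (Module.finrank ℂ (P a).toSubmodule : ℝ) ≠ 0 := by
    exact_mod_cast (finrank_pos_of_decomposition hP a).ne'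
  have h1 := (isMultFreeSystem hP hv hdeg e he).sum_neighbourWeight_right ha
  rw [Finset.sum_congr rfl fun b hb => ?_, ← Finset.sum_div, h1, Fintype.card_fin,
    mul_div_cancel_left₀ _ h0]
  have hb' : deg a = deg b + 1 := by
    rw [ha, show deg b = m by simpa using hb]
  rw [deathRate, if_pos hb', genBinom_eq hP hv hdeg e he hb']

end Rates

end MultFree

end

theorem proposition3p3
    {V : Type*} [NormedAddCommGroup V] [InnerProductSpace ℂ V] [FiniteDimensional ℂ V]
    [MeasurableSpace V] [BorelSpace V]
    (K : Subgroup (V ≃ₗᵢ[ℂ] V)) (hK : MultFree.IsClosedSubgroup K)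
    -- the decomposition of `ℂ[V]` into irreducible subspaces `P_λ`
    {Λ : Type*} (P : Λ → Subrepresentation (MultFree.polyRep K))
    (hP : MultFree.IsMultiplicityFreeDecomposition K P)
    -- `n = dim V`, `|λ|` and `d_λ`
    (n : ℕ) (hn : n = Module.finrank ℂ V)
    (deg : Λ → ℕ) (hdeg : ∀ a, deg a = MultFree.homDegree (P a).toSubmodule)
    (d : Λ → ℕ) (hd : ∀ a, d a = Module.finrank ℂ (P a).toSubmodule)
    -- orthonormal bases of the `P_λ`
    (v : ∀ a, Fin (Module.finrank ℂ (P a).toSubmodule) → V → ℂ)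
    (hv : ∀ a, MultFree.IsFockONB (P a).toSubmodule (v a))
    -- an ordering of `Λ` in which `α` precedes `β` whenever `|α| < |β|`
    (e : ℕ ≃ Λ) (he : ∀ i j, deg (e i) < deg (e j) → i < j)
    -- the generalized binomial coefficients
    (B : Λ → Λ → ℝ) (hB : B = MultFree.genBinom deg (fun a => MultFree.invPoly (v a)) e)
    {Ω : Type*} [MeasurableSpace Ω] (μ : MeasureTheory.Measure Ω)
    [MeasureTheory.IsProbabilityMeasure μ] (X : NNReal → Ω → Λ) :
    -- the pure birth process
    ((∃ p, MultFree.IsMarkovChain μ X p (MultFree.birthRate n deg d B)) →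
      MultFree.IsMarkovChain μ (fun t ω => deg (X t ω))
        (MultFree.yuleProb n) (MultFree.yuleRate n)) ∧
    -- the pure death process
    ((∃ p, MultFree.IsMarkovChain μ X p (MultFree.deathRate deg B)) →
      MultFree.IsMarkovChain μ (fun t ω => deg (X t ω))
        MultFree.linearDeathProb MultFree.linearDeathRate) := by
  obtain rfl : d = fun a => Module.finrank ℂ (P a).toSubmodule := funext hd
  subst hn hB
  have : Infinite Λ := e.infinite_iff.1 inferInstance
  have hpos : 0 < Module.finrank ℂ V := MultFree.finrank_pos_of_infinite hP hv
  have hfin := MultFree.finite_level hP hv hdeg e he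
  constructor
  · rintro ⟨p, hX⟩
    refine hX.map_deg hfin (MultFree.isTransitionSemigroup_yuleProb hpos)
      (MultFree.hasTransitionRates_yuleProb hpos)
      (MultFree.sum_level_eq_yuleProb hpos hX.semigroup hX.rates hfin (fun a => ?_)
        (fun a b hab => ?_) (MultFree.sum_birthRate hP hv hdeg e he))
    · rw [MultFree.birthRate, if_neg (by omega), if_pos rfl]
      ring
    · rw [MultFree.birthRate_eq hP hv hdeg e he hab]
      exact div_nonneg (MultFree.neighbourWeight_nonneg _ _) (Nat.cast_nonneg _)
  · rintro ⟨p, hX⟩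
    refine hX.map_deg hfin MultFree.isTransitionSemigroup_linearDeathProb
      MultFree.hasTransitionRates_linearDeathProb
      (MultFree.sum_level_eq_linearDeathProb hX.semigroup hX.rates hfin (fun a => ?_)
        (MultFree.sum_deathRate hP hv hdeg e he))
    rw [MultFree.deathRate, if_neg (by omega), if_pos rfl]
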